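/- **Setting.** Let $L=L_1\cup\dots\cup L_n$ be a family of arcs in $\mathbb R^3$ with pairwise disjoint components (a component may intersect itself), each endpoint $x$ being constrained to an affine subspace $M_x$, and $L$ being constrained to avoid finitely many obstacles $\{g_j<0\}$, where $g_j$ is $C^1$ with regular value $0$. Its *Gehring thickness* $\mathrm{gThi}(L)$ is the minimal distance between points on different components, and $O(L)=\min_j\min_{x\in L}g_j(x)$. A continuous vector field $\xi$ along $L$ (a function of the parameter, so that it may take different values at a self-intersection) is *compatible* if it is tangent to $M_x$ at each endpoint $x$. The first variation of length $\delta_\xi\mathrm{Len}$ is the derivative of length along $C^1$ vector fields $\xi$, extended continuously to all continuous $\xi$; $\delta^+_\xi$ denotes the one-sided derivative at $t=0^+$ along $L+t\xi$. $L$ is *strongly critical* for Gehring ropelength if $\delta\mathrm{Len}$ exists as a continuous functional and there is $\varepsilon>0$ such that for every compatible $\xi$ with $\delta_\xi\mathrm{Len}=-1$ the one-sided variations exist and $\min\big(\delta^+_\xi\mathrm{gThi}(L),\delta^+_\xi O(L)\big)\le-\varepsilon$. Two configurations are *link-homotopic* if they are joined by a homotopy during which different components stay disjoint (a component may cross itself),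 endpoints stay in their subspaces and the obstacles are avoided. **Clasp arcs.** The $\tau=1$ clasp arc is the planar arc with horizontal coordinate $X(u)$ and height $Z(u)$, $0\le u\le1$, where $$X(u)=\sqrt{\frac{u^2\,(1-(1-u)^2)}{1-u^2(1-u)^2}},\qquad Z(u)=\int_0^u\frac{w}{\sqrt{1-w^2}}\,X'(w)\,dw ,$$ which has a horizontal tangent at $u=0$ and a vertical one at $u=1$. Put $H=Z(1)$. **Configuration.** Let $d>0$ and $c=\tfrac32H+d$. The floor is the plane $z=-c$ and the ceiling the plane $z=c$. The component $\beta$ lies in the plane $x_2=0$ with both endpoints on the floor, and is symmetric under $x_1\mapsto-x_1$. One half of it, in $(x_1,z)$-coordinates, consists of the vertical segment from $(1,-c)$ to $(1,-\tfrac32H)$, followed by the three clasp arcs $(X(u),-\tfrac12H-Z(u))$ with $u$ from $1$ to $0$, ending at $p=(0,-\tfrac12H)$; then $(-X(u),-\tfrac12H+Z(u))$ with $u$ from $0$ to $1$; then $(-X(u),\tfrac32H-Z(u))$ with $u$ from $1$ to $0$, ending at the tip $t=(0,\tfrac32H)$. The other half is its mirror image. The component $\gamma$ is the image of $\beta$ under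 the rotation $(x_1,x_2,z)\mapsto(x_2,x_1,-z)$; it lies in the perpendicular plane $x_1=0$ with its endpoints on the ceiling. Each endpoint is constrained to its floor or ceiling plane, and the half-spaces below the floor and above the ceiling are obstacles. **The granny clasp** $G_1$ is the link-homotopy class, with these constraints, of the following picture: near each of the two vertical lines $x_1=\pm2,\ x_2=0$, one strand of a rope with both ends on the floor and one strand of a rope with both ends on the ceiling are twisted around each other by three half-twists, of the same handedness on both sides; above the twists the two strands of the lower rope are joined, and below the twists the two strands of the upper rope are joined. (Joining the two free ends on the left and the two on the right gives a granny knot.) **Theorem 7.1.** For every $d>0$ the configuration $\beta\cup\gamma$ satisfies all the constraints, has Gehring thickness $1$, belongs to the link-homotopy class $G_1$, is not embedded (each component has exactly one point of self-intersection), and is strongly critical for Gehring ropelength. -/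

import Mathlib

noncomputable section

namespace Gehring

open Set unitInterval

/-- Euclidean three-space, with coordinates `x₁ = q 0`, `x₂ = q 1`, `z = q 2`. -/
abbrev E3 : Type := EuclideanSpace ℝ (Fin 3)

/-- The data of a generalized link all of whose components are arcs.  The components are indexed
by `ι` and parametrized by `[0,1]`; each endpoint is constrained to an affine subspace; and there
is an obstacle `{q | g j q < 0}` for each `j : J`. The conditions relating these data are in
`GenLink.IsGenLink`. -/
structure GenLink (ι J : Type) where
  /-- the components -/
  arc : ι → I → E3
  /-- the affine subspace to which the starting point `arc i 0` is constrained -/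
  M₀ : ι → AffineSubspace ℝ E3
  /-- the affine subspace to which the final point `arc i 1` is constrained -/
  M₁ : ι → AffineSubspace ℝ E3
  /-- the obstacle functions -/
  g : J → E3 → ℝ

/-- Total length of a family of arcs. -/
def len {ι : Type} [Fintype ι] (γ : ι → I → E3) : ℝ :=
  ∑ i, (eVariationOn (γ i) univ).toReal

/-- Gehring thickness: the minimal distance between points on different components. -/
def gThi {ι : Type} (γ : ι → I → E3) : ℝ :=
  sInf {r | ∃ i j, i ≠ j ∧ ∃ s t : I, r = dist (γ i s) (γ j t)}

/-- The obstacle function `min_j min_{x ∈ L} g_j(x)`. If there are no obstacles at all this is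
the constant `0`, so that the condition on its first variation in `GenLink.StronglyCritical`
is then void, as it should be. -/
def obst {ι J : Type} (g : J → E3 → ℝ) (γ : ι → I → E3) : ℝ :=
  sInf {r | ∃ j i, ∃ s : I, r = g j (γ i s)}

/-- The arcs, moved for time `t` with velocity `ξ`. -/
def move {ι : Type} (γ : ι → I → E3) (ξ : ι → C(I, E3)) (t : ℝ) : ι → I → E3 :=
  fun i s => γ i s + t • ξ i s

/-- The family of arcs `γ` is admissible for the constraints of `L`: its components are pairwise
disjoint (a single component may intersect itself), its endpoints lie on the prescribed affine
subspaces, and it avoids the obstacles. -/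
def GenLink.Admits {ι J : Type} (L : GenLink ι J) (γ : ι → I → E3) : Prop :=
  (∀ i j, i ≠ j → ∀ s t : I, γ i s ≠ γ j t) ∧
  (∀ i, γ i 0 ∈ L.M₀ i ∧ γ i 1 ∈ L.M₁ i) ∧
  (∀ j i, ∀ s : I, 0 ≤ L.g j (γ i s))

/-- `L` is a generalized link: its arcs are continuous and admissible, and every obstacle function
is `C¹` and has `0` as a regular value. -/
def GenLink.IsGenLink {ι J : Type} (L : GenLink ι J) : Prop :=
  (∀ i, Continuous (L.arc i)) ∧ L.Admits L.arc ∧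
  (∀ j, ContDiff ℝ 1 (L.g j) ∧ ∀ q, L.g j q = 0 → fderiv ℝ (L.g j) q ≠ 0)

/-- Link homotopy of `L` to the arcs `δ` under the constraints of `L`: the components stay
disjoint from each other, but may cross themselves; the endpoints move within their affine
subspaces, and the obstacles are avoided. -/
def GenLink.LinkHomotopicTo {ι J : Type} (L : GenLink ι J) (δ : ι → I → E3) : Prop :=
  ∃ h : ι → I × I → E3, (∀ i, Continuous (h i)) ∧
    (∀ i s, h i (0, s) = L.arc i s) ∧ (∀ i s, h i (1, s) = δ i s) ∧
    ∀ τ : I, L.Admits fun i s => h i (τ, s)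

/-- A continuous vector field along `L` is compatible if it is tangent, at each endpoint, to the
affine subspace to which that endpoint is constrained. -/
def GenLink.Compatible {ι J : Type} (L : GenLink ι J) (ξ : ι → C(I, E3)) : Prop :=
  ∀ i, ξ i 0 ∈ (L.M₀ i).direction ∧ ξ i 1 ∈ (L.M₁ i).direction

/-- `F` is the first variation of length `ξ ↦ δ_ξ Len` of the arcs `γ`. The arcs are rectifiable,
`F` is the derivative of length along every `C¹` vector field, and it is extended to continuous
vector fields by continuity, that is (Riesz), as minus the integral against a vector-valued
Radon measure, the curvature force. As `C¹` fields are dense, there is at most one such `F`. -/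
def IsFirstVariationOfLen {ι : Type} [Fintype ι] (γ : ι → I → E3)
    (F : (ι → C(I, E3)) →L[ℝ] ℝ) : Prop :=
  (∀ i, eVariationOn (γ i) univ ≠ ⊤) ∧
  ∀ ξ : ι → C(I, E3),
    (∀ i, ∃ f : ℝ → E3, ContDiff ℝ 1 f ∧ ∀ s : I, ξ i s = f s) →
    HasDerivAt (fun t : ℝ => len (move γ ξ t)) (F ξ) 0

/-- Strong criticality for length when constrained by Gehring thickness (and by the endpoint
constraints and obstacles). The numbers `a` and `b` are the one-sided first variations of the
Gehring thickness and of the obstacle function; their existence is part of the claim. -/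
def GenLink.StronglyCritical {ι J : Type} [Fintype ι] (L : GenLink ι J) : Prop :=
  ∃ F : (ι → C(I, E3)) →L[ℝ] ℝ, IsFirstVariationOfLen L.arc F ∧
    ∃ ε : ℝ, 0 < ε ∧ ∀ ξ : ι → C(I, E3), L.Compatible ξ → F ξ = -1 →
      ∃ a b : ℝ,
        HasDerivWithinAt (fun t : ℝ => gThi (move L.arc ξ t)) a (Ici 0) 0 ∧
        HasDerivWithinAt (fun t : ℝ => obst L.g (move L.arc ξ t)) b (Ici 0) 0 ∧
        min a b ≤ -ε

/-! ### The `τ = 1` clasp arc -/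

/-- Horizontal coordinate on the `τ = 1` clasp arc, at the point where the unit tangent vector has
vertical component `u ∈ [0,1]`. It comes from
`x₁² = u₁² (1 - u₂²) / (1 - u₁² u₂²)` and the balance equation `u₁ + u₂ = 1`. -/
def claspX (u : ℝ) : ℝ :=
  Real.sqrt (u ^ 2 * (1 - (1 - u) ^ 2) / (1 - u ^ 2 * (1 - u) ^ 2))

/-- Height above the tip on the `τ = 1` clasp arc, from `dz/dx = u / √(1 - u²)`. -/
def claspZ (u : ℝ) : ℝ :=
  ∫ w in (0 : ℝ)..u, w / Real.sqrt (1 - w ^ 2) * deriv claspX w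

/-- The vertical extent of one `τ = 1` clasp (which is the height of each clasp arc). -/
def claspH : ℝ := claspZ 1

/-! ### The critical configuration of the granny clasp

The levels of `t'`, `p`, `p'`, `t` are `-3H/2`, `-H/2`, `H/2`, `3H/2`, with `H = claspH`. The floor
and the ceiling are at distance `d` below `t'` and above `t`, that is at height `∓(3H/2 + d)`. -/

/-- The height of the ceiling above the middle level, if the straight segments have length `d`. -/
def ceil (d : ℝ) : ℝ := 3 * claspH / 2 + d

/-- Horizontal coordinate (in the plane `x₂ = 0`) of the half of `β` that starts on the right:
a vertical segment (`0 ≤ s ≤ 1`) and three clasp arcs, `1 ≤ s ≤ 2` up to the point `p` of the axis,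
then on the other side of the axis `2 ≤ s ≤ 3` up to the level of `p'`, and `3 ≤ s ≤ 4` up to the
tip `t`. -/
def halfX (s : ℝ) : ℝ :=
  if s ≤ 1 then 1
  else if s ≤ 2 then claspX (2 - s)
  else if s ≤ 3 then -claspX (s - 2)
  else -claspX (4 - s)

/-- Height of the same half of `β`. -/
def halfZ (d s : ℝ) : ℝ :=
  if s ≤ 1 then -ceil d + s * d
  else if s ≤ 2 then -claspH / 2 - claspZ (2 - s)
  else if s ≤ 3 then -claspH / 2 + claspZ (s - 2)
  else 3 * claspH / 2 - claspZ (4 - s)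

/-- The component `β` attached to the floor: the half above, up to the tip, followed by its mirror
image in the `z`-axis, traversed downwards. -/
def beta (d : ℝ) (s : I) : E3 :=
  if (s : ℝ) ≤ 1 / 2 then !₂[halfX (8 * s), 0, halfZ d (8 * s)]
  else !₂[-halfX (8 * (1 - s)), 0, halfZ d (8 * (1 - s))]

/-- The component `γ` attached to the ceiling: the image of `β` under the rotation
`(x₁, x₂, z) ↦ (x₂, x₁, -z)`. -/
def gamma (d : ℝ) (s : I) : E3 := !₂[beta d s 1, beta d s 0, -(beta d s 2)]

/-- The horizontal plane at height `c`. -/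
def horizontalPlane (c : ℝ) : AffineSubspace ℝ E3 :=
  AffineSubspace.mk' !₂[0, 0, c] (LinearMap.ker (EuclideanSpace.proj (𝕜 := ℝ) (2 : Fin 3) : E3 →L[ℝ] ℝ).toLinearMap)

/-- The granny clasp in its configuration built from clasp arcs: component `0` is `β`, with both
ends on the floor, component `1` is `γ`, with both ends on the ceiling; the half-spaces below the
floor and above the ceiling are obstacles. -/
def grannyClasp (d : ℝ) : GenLink (Fin 2) (Fin 2) where
  arc := ![beta d, gamma d]
  M₀ := ![horizontalPlane (-ceil d), horizontalPlane (ceil d)]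
  M₁ := ![horizontalPlane (-ceil d), horizontalPlane (ceil d)]
  g := ![fun q => q 2 + ceil d, fun q => ceil d - q 2]

/-! ### The link-homotopy class

The standard picture of the granny clasp between the floor `z = -h` and the ceiling `z = h`. Near
each of the two vertical lines `x₁ = ±2`, `x₂ = 0`, one strand of the lower rope and one strand of
the upper rope are twisted around each other by three right-handed half-twists. Above the twists
the two strands of the lower rope are joined, below them the two strands of the upper rope. (Joining
the two free ends at the left and the two free ends at the right gives the connect sum of two
trefoils of the same handedness.) -/

/-- Twisting angle at height `ζ h`; it runs from `0` to `3π` for `-1/3 ≤ ζ ≤ 1/3`. -/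
def twist (ζ : ℝ) : ℝ := 3 * Real.pi * (3 * ζ + 1) / 2

/-- First horizontal coordinate, at height `ζ h` with `-1 ≤ ζ ≤ 2/3`, of the strand of the lower
rope on the right: it goes straight up, is twisted, and then leads to the tip on the axis. -/
def strandX (ζ : ℝ) : ℝ :=
  if ζ ≤ -1 / 3 then 3 else if ζ ≤ 1 / 3 then 2 + Real.cos (twist ζ) else 2 - 3 * ζ

/-- Second horizontal coordinate of that strand. -/
def strandY (ζ : ℝ) : ℝ :=
  if ζ ≤ -1 / 3 then 0 else if ζ ≤ 1 / 3 then Real.sin (twist ζ) else 0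

/-- The lower rope: the strand on the right traversed upwards, at height `ζ h` with `ζ` running from
`-1` to `2/3`, followed by its image under the half-turn about the `z`-axis, traversed downwards. -/
def lowerRope (h : ℝ) (s : I) : E3 :=
  if (s : ℝ) ≤ 1 / 2 then
    !₂[strandX (-1 + 10 / 3 * s), strandY (-1 + 10 / 3 * s), h * (-1 + 10 / 3 * s)]
  else
    !₂[-strandX (-1 + 10 / 3 * (1 - s)), -strandY (-1 + 10 / 3 * (1 - s)),
      h * (-1 + 10 / 3 * (1 - s))]

/-- The upper rope: the image of the lower rope under the half-turn about the `x₁`-axis. -/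
def upperRope (h : ℝ) (s : I) : E3 :=
  !₂[lowerRope h s 0, -(lowerRope h s 1), -(lowerRope h s 2)]

/-- The two ropes in the standard picture of the granny clasp. -/
def grannyPicture (h : ℝ) : Fin 2 → I → E3 := ![lowerRope h, upperRope h]

end Gehring

end

noncomputable section

namespace Gehring

open Set unitInterval MeasureTheory

/-! ### The clasp arc -/

/-! Strong criticality is a force balance. The configuration is a stack of three clasps. In each of
them the point with parameter `u` on an arc of one component is joined by struts of length 1 to
points with parameter `1 - u` on two mirror-image arcs of the other. Three facts about a single
clasp carry everything. The strut with horizontal components `claspX u`, `claspX (1 - u)` and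
vertical component `gap u` has unit length (`strut_sq`). It is orthogonal to both arcs
(`claspX_eq_gap_mul_slope`). It really joins the two points, because `claspZ u + claspZ (1 - u) +
gap u` is constant (`claspH_sub_eq_gap`). Monotonicity of the distance on either side of a strut
then shows that no two points of a clasp are closer than 1 (`one_le_clasp_dist`), whence thickness
1.

For the balance, the two struts at a point of `β` have opposite components across the plane of `β`.
Their sum is therefore `2 * gap u` times the curvature force density `arcForce` there, and the same
holds for `γ` (`strutRate_eq`). So for a compatible field the first variation of length is the
integral of the rates of change of the twelve strut lengths at `u`, weighted by `1 / (2 * gap u)`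
(`grannyVariation_eq_integral`). By Danskin's theorem the one-sided variation `a` of the thickness
is at most each of these rates. If length varies at rate `-1`, then `-1 ≥ 6 * a * ∫ 1 / gap`, which
bounds `a` by a fixed negative number because `1 / gap` is integrable. The obstacles contribute only
the existence of their variation.

For the link homotopy, each component is first straightened inside its own plane, to horizontal
position `2 cos α` at a height with screw angle `α`. Turning that height by `α` gives `(2 cos² α, 2
cos α sin α) = (1 + cos 2α, sin 2α)`, a point circling the line `x₁ = 1`, and the other rope lands
diametrically opposite. A final horizontal shift separates the two twisted pairs. -/

/-- Slope `dz/dx` of the clasp arc at parameter `u`. -/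
def claspSlope (u : ℝ) : ℝ := u / Real.sqrt (1 - u ^ 2)

/-- Vertical component of the strut that ends at parameter `u` of a clasp arc. -/
def gap (u : ℝ) : ℝ :=
  Real.sqrt ((1 - u ^ 2) * (1 - (1 - u) ^ 2) / (1 - u ^ 2 * (1 - u) ^ 2))

lemma clasp_denom_pos {u : ℝ} (hu : u ∈ Icc (0 : ℝ) 1) : 0 < 1 - u ^ 2 * (1 - u) ^ 2 := by
  obtain ⟨h0, h1⟩ := hu
  have h : u * (1 - u) ≤ 1 / 4 := by nlinarith [sq_nonneg (u - 1 / 2)]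
  have h' : 0 ≤ u * (1 - u) := mul_nonneg h0 (by linarith)
  nlinarith

lemma claspX_nonneg (u : ℝ) : 0 ≤ claspX u := Real.sqrt_nonneg _

lemma gap_nonneg (u : ℝ) : 0 ≤ gap u := Real.sqrt_nonneg _

lemma claspX_zero : claspX 0 = 0 := by simp [claspX]

lemma claspX_one : claspX 1 = 1 := by simp [claspX]

lemma claspZ_zero : claspZ 0 = 0 := by simp [claspZ]

lemma gap_one_sub (u : ℝ) : gap (1 - u) = gap u := by
  unfold gap
  congr 1
  ring_nf

lemma clasp_radicand_nonneg {u : ℝ} (hu : u ∈ Icc (0 : ℝ) 1) :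
    0 ≤ u ^ 2 * (1 - (1 - u) ^ 2) / (1 - u ^ 2 * (1 - u) ^ 2) := by
  have := clasp_denom_pos hu
  obtain ⟨h0, h1⟩ := hu
  have : 0 ≤ 1 - (1 - u) ^ 2 := by nlinarith
  positivity

lemma claspX_sq {u : ℝ} (hu : u ∈ Icc (0 : ℝ) 1) :
    claspX u ^ 2 = u ^ 2 * (1 - (1 - u) ^ 2) / (1 - u ^ 2 * (1 - u) ^ 2) :=
  Real.sq_sqrt (clasp_radicand_nonneg hu)

lemma gap_sq {u : ℝ} (hu : u ∈ Icc (0 : ℝ) 1) :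
    gap u ^ 2 = (1 - u ^ 2) * (1 - (1 - u) ^ 2) / (1 - u ^ 2 * (1 - u) ^ 2) := by
  have := clasp_denom_pos hu
  obtain ⟨h0, h1⟩ := hu
  have h2 : 0 ≤ 1 - (1 - u) ^ 2 := by nlinarith
  have h3 : 0 ≤ 1 - u ^ 2 := by nlinarith
  exact Real.sq_sqrt (by positivity)

lemma one_sub_mem_Icc {u : ℝ} (hu : u ∈ Icc (0 : ℝ) 1) : 1 - u ∈ Icc (0 : ℝ) 1 :=
  ⟨by linarith [hu.2], by linarith [hu.1]⟩

lemma one_sub_mem_Ioo {u : ℝ} (hu : u ∈ Ioo (0 : ℝ) 1) : 1 - u ∈ Ioo (0 : ℝ) 1 :=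
  ⟨by linarith [hu.2], by linarith [hu.1]⟩

/-- With `v = 1 - u`, the numerators `u²(1 - v²)`, `v²(1 - u²)` and `(1 - u²)(1 - v²)` add up to the
common denominator `1 - u²v²`. -/
lemma strut_sq {u : ℝ} (hu : u ∈ Icc (0 : ℝ) 1) :
    claspX u ^ 2 + claspX (1 - u) ^ 2 + gap u ^ 2 = 1 := by
  have h := clasp_denom_pos hu
  rw [claspX_sq hu, claspX_sq (one_sub_mem_Icc hu), gap_sq hu]
  have e : 1 - (1 - u) ^ 2 * (1 - (1 - u)) ^ 2 = 1 - u ^ 2 * (1 - u) ^ 2 := by ring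
  rw [e]
  field_simp
  ring

lemma sqrt_one_sub_sq_pos {u : ℝ} (hu : u ∈ Ioo (0 : ℝ) 1) : 0 < Real.sqrt (1 - u ^ 2) :=
  Real.sqrt_pos.2 (by nlinarith [hu.1, hu.2])

lemma slope_pos {u : ℝ} (hu : u ∈ Ioo (0 : ℝ) 1) : 0 < claspSlope u :=
  div_pos hu.1 (sqrt_one_sub_sq_pos hu)

lemma gap_pos {u : ℝ} (hu : u ∈ Ioo (0 : ℝ) 1) : 0 < gap u := by
  have h := clasp_denom_pos (Ioo_subset_Icc_self hu)
  obtain ⟨h0, h1⟩ := hu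
  have h2 : 0 < 1 - (1 - u) ^ 2 := by nlinarith
  have h3 : 0 < 1 - u ^ 2 := by nlinarith
  exact Real.sqrt_pos.2 (by positivity)

/-- Orthogonality of the strut to the arc: up to signs, the strut has components `claspX u` and `gap
u` in the plane of the arc, whose tangent is `(1, claspSlope u)`. This makes strut length stationary
and lets the struts carry the curvature force. -/
lemma claspX_eq_gap_mul_slope {u : ℝ} (hu : u ∈ Ioo (0 : ℝ) 1) :
    claspX u = gap u * claspSlope u := by
  have hs := slope_pos hu
  have hg := gap_pos hu
  refine (sq_eq_sq₀ (claspX_nonneg u) (by positivity)).1 ?_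
  have h3 : 0 < 1 - u ^ 2 := by nlinarith [hu.1, hu.2]
  have h := clasp_denom_pos (Ioo_subset_Icc_self hu)
  rw [mul_pow, claspX_sq (Ioo_subset_Icc_self hu), gap_sq (Ioo_subset_Icc_self hu),
    claspSlope, div_pow, Real.sq_sqrt h3.le]
  field_simp

lemma claspX_pos {u : ℝ} (hu : u ∈ Ioc (0 : ℝ) 1) : 0 < claspX u := by
  have h := clasp_denom_pos (Ioc_subset_Icc_self hu)
  obtain ⟨h0, h1⟩ := hu
  have h2 : 0 < 1 - (1 - u) ^ 2 := by nlinarith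
  exact Real.sqrt_pos.2 (by positivity)

lemma continuousOn_claspX : ContinuousOn claspX (Icc 0 1) := by
  refine Real.continuous_sqrt.comp_continuousOn (ContinuousOn.div (by fun_prop) (by fun_prop) ?_)
  exact fun u hu => (clasp_denom_pos hu).ne'

lemma continuousOn_gap : ContinuousOn gap (Icc 0 1) := by
  refine Real.continuous_sqrt.comp_continuousOn (ContinuousOn.div (by fun_prop) (by fun_prop) ?_)
  exact fun u hu => (clasp_denom_pos hu).ne'

/-! ### Monotonicity and smoothness of the horizontal coordinate. -/

/-- Derivative of the radicand in `claspX`. -/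
def claspRadicandDeriv (u : ℝ) : ℝ :=
  ((6 * u ^ 2 - 4 * u ^ 3) * (1 - u ^ 2 * (1 - u) ^ 2)
    - u ^ 3 * (2 - u) * (-(2 * u * (1 - u) * (1 - 2 * u)))) / (1 - u ^ 2 * (1 - u) ^ 2) ^ 2

lemma claspRadicandDeriv_pos {u : ℝ} (hu : u ∈ Ioo (0 : ℝ) 1) : 0 < claspRadicandDeriv u := by
  have h := clasp_denom_pos (Ioo_subset_Icc_self hu)
  obtain ⟨h0, h1⟩ := hu
  refine div_pos ?_ (by positivity)
  have e : (6 * u ^ 2 - 4 * u ^ 3) * (1 - u ^ 2 * (1 - u) ^ 2)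
      - u ^ 3 * (2 - u) * (-(2 * u * (1 - u) * (1 - 2 * u))) =
      2 * u ^ 2 * ((3 - 2 * u) * (1 - u ^ 2 * (1 - u) ^ 2)
        - u ^ 2 * (2 - u) * ((1 - u) * (2 * u - 1))) := by ring
  rw [e]
  refine mul_pos (by positivity) ?_
  -- The denominator stays above `15/16`, while `(1 - u)(2u - 1)` peaks at `u = 3/4` with value
  -- `1/8`, so the subtracted term is at most `2 · 1/8`.
  have hq : u * (1 - u) ≤ 1 / 4 := by nlinarith [sq_nonneg (u - 1 / 2)]
  have hq0 : 0 ≤ u * (1 - u) := mul_nonneg h0.le (by linarith)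
  have a1 : 15 / 16 ≤ 1 - u ^ 2 * (1 - u) ^ 2 := by nlinarith
  have a2 : 15 / 16 ≤ (3 - 2 * u) * (1 - u ^ 2 * (1 - u) ^ 2) := by nlinarith
  have a3 : (1 - u) * (2 * u - 1) ≤ 1 / 8 := by nlinarith [sq_nonneg (u - 3 / 4)]
  have a4 : u ^ 2 * (2 - u) ≤ 2 := by nlinarith [mul_nonneg h0.le h0.le]
  have a5 : 0 ≤ u ^ 2 * (2 - u) := mul_nonneg (by positivity) (by linarith)
  nlinarith

lemma hasDerivAt_claspX {u : ℝ} (hu : u ∈ Ioc (0 : ℝ) 1) :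
    HasDerivAt claspX (claspRadicandDeriv u / (2 * claspX u)) u := by
  have h := clasp_denom_pos (Ioc_subset_Icc_self hu)
  have hN : HasDerivAt (fun u : ℝ => u ^ 2 * (1 - (1 - u) ^ 2)) (6 * u ^ 2 - 4 * u ^ 3) u := by
    have := ((hasDerivAt_id u).pow 2).mul (((((hasDerivAt_id u).const_sub 1).pow 2).const_sub 1))
    refine (this.congr_deriv ?_)
    simp
    ring
  have hD : HasDerivAt (fun u : ℝ => 1 - u ^ 2 * (1 - u) ^ 2)
      (-(2 * u * (1 - u) * (1 - 2 * u))) u := by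
    have := (((hasDerivAt_id u).pow 2).mul (((hasDerivAt_id u).const_sub 1).pow 2)).const_sub 1
    refine (this.congr_deriv ?_)
    simp
    ring
  have hr := (hN.fun_div hD h.ne').sqrt (by
    have := claspX_pos hu
    exact (Real.sqrt_pos.1 this).ne')
  refine hr.congr_deriv ?_
  unfold claspRadicandDeriv claspX
  congr 2
  ring

lemma deriv_claspX {u : ℝ} (hu : u ∈ Ioc (0 : ℝ) 1) :
    deriv claspX u = claspRadicandDeriv u / (2 * claspX u) :=
  (hasDerivAt_claspX hu).deriv

lemma deriv_claspX_pos {u : ℝ} (hu : u ∈ Ioo (0 : ℝ) 1) : 0 < deriv claspX u := by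
  rw [deriv_claspX (Ioo_subset_Ioc_self hu)]
  have := claspX_pos (Ioo_subset_Ioc_self hu)
  have := claspRadicandDeriv_pos hu
  positivity

lemma continuousOn_deriv_claspX : ContinuousOn (deriv claspX) (Ioc 0 1) := by
  have : ContinuousOn (fun u => claspRadicandDeriv u / (2 * claspX u)) (Ioc 0 1) := by
    refine ContinuousOn.div (ContinuousOn.div (by fun_prop) (by fun_prop) ?_)
      (continuousOn_const.mul (continuousOn_claspX.mono Ioc_subset_Icc_self)) ?_
    · exact fun u hu => pow_ne_zero _ (clasp_denom_pos (Ioc_subset_Icc_self hu)).ne'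
    · exact fun u hu => (mul_pos two_pos (claspX_pos hu)).ne'
  exact this.congr fun u hu => deriv_claspX hu

lemma hasDerivAt_claspX' {u : ℝ} (hu : u ∈ Ioo (0 : ℝ) 1) :
    HasDerivAt claspX (deriv claspX u) u :=
  (hasDerivAt_claspX (Ioo_subset_Ioc_self hu)).differentiableAt.hasDerivAt

lemma hasDerivAt_sqrt_one_sub_sq {u : ℝ} (hu : u ∈ Ioo (0 : ℝ) 1) :
    HasDerivAt (fun u : ℝ => Real.sqrt (1 - u ^ 2)) (-claspSlope u) u := by
  have h3 : 0 < 1 - u ^ 2 := by nlinarith [hu.1, hu.2]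
  have := (((hasDerivAt_id u).pow 2).const_sub 1).sqrt (by simpa using h3.ne')
  refine this.congr_deriv ?_
  simp [claspSlope]
  field_simp

/-! ### Integrability of the singular derivatives. -/

lemma intervalIntegrable_slope : IntervalIntegrable claspSlope volume 0 1 := by
  -- The slope blows up at `1`, but it is nonnegative and has a primitive continuous up to the
  -- endpoint, which forces integrability.
  refine intervalIntegral.intervalIntegrable_deriv_of_nonneg
    (g := fun u => -Real.sqrt (1 - u ^ 2)) (by fun_prop) ?_ ?_
  · intro u hu
    exact (hasDerivAt_sqrt_one_sub_sq (by simpa using hu)).fun_neg.congr_deriv (neg_neg _)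
  · intro u hu
    exact (slope_pos (by simpa using hu)).le

lemma continuousOn_slope : ContinuousOn claspSlope (Ioo 0 1) :=
  ContinuousOn.div (by fun_prop) (by fun_prop) fun _ hu => (sqrt_one_sub_sq_pos hu).ne'

lemma intervalIntegrable_deriv_claspX : IntervalIntegrable (deriv claspX) volume 0 1 := by
  refine intervalIntegral.intervalIntegrable_deriv_of_nonneg
    (g := claspX) (by simpa using continuousOn_claspX) ?_ ?_
  · intro u hu
    exact hasDerivAt_claspX' (by simpa using hu)
  · intro u hu
    exact (deriv_claspX_pos (by simpa using hu)).le

lemma intervalIntegrable_deriv_claspZ :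
    IntervalIntegrable (fun w => claspSlope w * deriv claspX w) volume 0 1 := by
  -- Near `0` the slope is continuous and `deriv claspX` integrable; near `1` the roles are
  -- exchanged. Splitting avoids multiplying two merely integrable functions.
  refine IntervalIntegrable.trans (b := 1 / 2) ?_ ?_
  · refine (intervalIntegrable_deriv_claspX.mono_set ?_).continuousOn_mul ?_
    · rw [uIcc_of_le (by norm_num), uIcc_of_le (by norm_num)]
      exact Icc_subset_Icc_right (by norm_num)
    · rw [uIcc_of_le (by norm_num)]
      refine ContinuousOn.div (by fun_prop) (by fun_prop) fun u hu => ?_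
      exact (Real.sqrt_pos.2 (by nlinarith [hu.1, hu.2])).ne'
  · refine (intervalIntegrable_slope.mono_set ?_).mul_continuousOn ?_
    · rw [uIcc_of_le (by norm_num), uIcc_of_le (by norm_num)]
      exact Icc_subset_Icc_left (by norm_num)
    · rw [uIcc_of_le (by norm_num)]
      exact continuousOn_deriv_claspX.mono fun u hu => ⟨by linarith [hu.1], hu.2⟩

lemma hasDerivAt_claspZ {u : ℝ} (hu : u ∈ Ioo (0 : ℝ) 1) :
    HasDerivAt claspZ (claspSlope u * deriv claspX u) u := by
  have hc : ContinuousOn (fun w => claspSlope w * deriv claspX w) (Ioo 0 1) :=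
    continuousOn_slope.mul (continuousOn_deriv_claspX.mono Ioo_subset_Ioc_self)
  refine intervalIntegral.integral_hasDerivAt_right
    (intervalIntegrable_deriv_claspZ.mono_set ?_) ?_ (hc.continuousAt (Ioo_mem_nhds hu.1 hu.2))
  · rw [uIcc_of_le hu.1.le, uIcc_of_le zero_le_one]
    exact Icc_subset_Icc_right hu.2.le
  · exact hc.stronglyMeasurableAtFilter isOpen_Ioo u hu

lemma continuousOn_claspZ : ContinuousOn claspZ (Icc 0 1) := by
  have := intervalIntegral.continuousOn_primitive_interval' intervalIntegrable_deriv_claspZ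
    (a := 0) (by simp)
  rwa [uIcc_of_le zero_le_one] at this

lemma strictMonoOn_claspZ : StrictMonoOn claspZ (Icc 0 1) := by
  refine strictMonoOn_of_deriv_pos (convex_Icc 0 1) continuousOn_claspZ fun u hu => ?_
  rw [interior_Icc] at hu
  rw [(hasDerivAt_claspZ hu).deriv]
  exact mul_pos (slope_pos hu) (deriv_claspX_pos hu)

lemma claspZ_nonneg {u : ℝ} (hu : u ∈ Icc (0 : ℝ) 1) : 0 ≤ claspZ u := by
  rw [← claspZ_zero]
  exact strictMonoOn_claspZ.monotoneOn (by simp) hu hu.1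

lemma claspZ_le {u : ℝ} (hu : u ∈ Icc (0 : ℝ) 1) : claspZ u ≤ claspH :=
  strictMonoOn_claspZ.monotoneOn hu (by simp) hu.2

/-! ### Struts of a single clasp. -/

lemma hasDerivAt_gap {u : ℝ} (hu : u ∈ Ioo (0 : ℝ) 1) :
    HasDerivAt gap
      (-(claspSlope u * deriv claspX u) + claspSlope (1 - u) * deriv claspX (1 - u)) u := by
  have hv := one_sub_mem_Ioo hu
  have hg := gap_pos hu
  have h1 := hasDerivAt_claspX' hu
  have h2 : HasDerivAt (fun u => claspX (1 - u)) (-deriv claspX (1 - u)) u := by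
    have := (hasDerivAt_claspX' hv).comp u ((hasDerivAt_id u).const_sub 1)
    simpa [Function.comp_def] using this
  have hsq := strut_sq (Ioo_subset_Icc_self hu)
  have e : gap u = Real.sqrt (1 - claspX u ^ 2 - claspX (1 - u) ^ 2) := by
    rw [← Real.sqrt_sq hg.le]
    congr 1
    linarith
  have h3 := (((h1.pow 2).const_sub 1).sub (h2.pow 2)).sqrt (by
    have : 0 < gap u ^ 2 := by positivity
    simp only [Pi.pow_apply, Pi.sub_apply]
    linarith)
  have h4 : HasDerivAt gap _ u := h3.congr_of_eventuallyEq (by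
    filter_upwards [Ioo_mem_nhds hu.1 hu.2] with w hw
    have hsq := strut_sq (Ioo_subset_Icc_self hw)
    rw [← Real.sqrt_sq (gap_nonneg w)]
    simp only [Pi.pow_apply, Pi.sub_apply]
    congr 1
    linarith)
  refine h4.congr_deriv ?_
  -- Differentiating `strut_sq` gives the quotients `claspX u / gap u` and `claspX (1 - u) / gap u`;
  -- orthogonality at both ends of the strut turns them into slopes.
  have e1 := claspX_eq_gap_mul_slope hu
  have e2 := claspX_eq_gap_mul_slope hv
  rw [gap_one_sub] at e2
  simp only [Pi.pow_apply, Pi.sub_apply]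
  rw [← e]
  simp only [e1, e2]
  field_simp
  ring

/-- The tips of a clasp are at distance `claspH`, so that this says that opposite points of a
clasp, at parameters `u` and `1 - u`, are `gap u` apart vertically. -/
lemma claspH_sub_eq_gap {u : ℝ} (hu : u ∈ Icc (0 : ℝ) 1) :
    claspH - claspZ u - claspZ (1 - u) = gap u := by
  have hc : ContinuousOn (fun u => claspZ u + claspZ (1 - u) + gap u) (Icc 0 1) :=
    (continuousOn_claspZ.add (continuousOn_claspZ.comp (by fun_prop)
      fun u hu => one_sub_mem_Icc hu)).add continuousOn_gap
  -- The height derivatives cancel that of `gap`, so the sum is constant; at `u = 0` it equals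
  -- `claspZ 1`, which is `claspH`.
  have hd : ∀ u ∈ Ioo (0 : ℝ) 1,
      HasDerivAt (fun u => claspZ u + claspZ (1 - u) + gap u) 0 u := by
    intro u hu
    have h2 : HasDerivAt (fun u => claspZ (1 - u))
        (-(claspSlope (1 - u) * deriv claspX (1 - u))) u := by
      have := (hasDerivAt_claspZ (one_sub_mem_Ioo hu)).comp u ((hasDerivAt_id u).const_sub 1)
      simpa [Function.comp_def] using this
    exact (((hasDerivAt_claspZ hu).add h2).add (hasDerivAt_gap hu)).congr_deriv (by ring)
  have key : ∀ u ∈ Icc (0 : ℝ) 1, claspZ u + claspZ (1 - u) + gap u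
      = claspZ 0 + claspZ (1 - 0) + gap 0 := by
    intro u hu
    rcases hu.1.eq_or_lt with rfl | h0
    · rfl
    have hF : ∫ w in (0 : ℝ)..u, (0 : ℝ) = (claspZ u + claspZ (1 - u) + gap u) -
        (claspZ 0 + claspZ (1 - 0) + gap 0) :=
      intervalIntegral.integral_eq_sub_of_hasDerivAt_of_le (f' := fun _ => (0 : ℝ))
        (f := fun u => claspZ u + claspZ (1 - u) + gap u) hu.1
        (hc.mono (Icc_subset_Icc_right hu.2))
        (fun w hw => hd w ⟨hw.1, hw.2.trans_le hu.2⟩) (by simp)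
    simp only [intervalIntegral.integral_zero] at hF
    linarith
  have h := key u hu
  have g0 : gap 0 = 0 := by simp [gap]
  rw [claspZ_zero, g0, sub_zero] at h
  unfold claspH
  linarith

/-- For fixed `v`, the `u`-derivative of the squared distance has the sign of `claspZ v - claspZ (1
- u)`. It therefore decreases up to `u = 1 - v` and increases afterwards, and at that point it is
the squared strut length 1. -/
lemma one_le_clasp_dist {u v : ℝ} (hu : u ∈ Icc (0 : ℝ) 1) (hv : v ∈ Icc (0 : ℝ) 1) :
    1 ≤ claspX u ^ 2 + claspX v ^ 2 + (claspH - claspZ u - claspZ v) ^ 2 := by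
  set f : ℝ → ℝ := fun u => claspX u ^ 2 + claspX v ^ 2 + (claspH - claspZ u - claspZ v) ^ 2
    with hf
  have hfc : ContinuousOn f (Icc 0 1) := by
    have := continuousOn_claspX
    have := continuousOn_claspZ
    fun_prop
  have hd : ∀ w ∈ Ioo (0 : ℝ) 1,
      HasDerivAt f (2 * deriv claspX w * claspSlope w * (claspZ v - claspZ (1 - w))) w := by
    intro w hw
    have h := (((hasDerivAt_claspX' hw).pow 2).add_const (claspX v ^ 2)).add
      ((((hasDerivAt_claspZ hw).const_sub claspH).sub_const (claspZ v)).pow 2)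
    refine h.congr_deriv ?_
    have e1 := claspX_eq_gap_mul_slope hw
    have e2 := claspH_sub_eq_gap (Ioo_subset_Icc_self hw)
    have e3 : claspX w = (claspH - claspZ w - claspZ (1 - w)) * claspSlope w := by rw [e1, e2]
    simp only [Nat.cast_ofNat, Nat.add_one_sub_one, pow_one]
    rw [e3]
    ring
  have hmin : f (1 - v) = 1 := by
    have e2 := claspH_sub_eq_gap hv
    have e3 := strut_sq hv
    simp only [hf]
    rw [show claspH - claspZ (1 - v) - claspZ v = gap v by linarith]
    linarith
  have hv' := one_sub_mem_Icc hv
  change 1 ≤ f u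
  rw [← hmin]
  rcases le_total u (1 - v) with h | h
  · refine antitoneOn_of_deriv_nonpos (convex_Icc 0 (1 - v))
      (hfc.mono (Icc_subset_Icc_right hv'.2)) ?_ ?_ ⟨hu.1, h⟩ ⟨hv'.1, le_rfl⟩ h
    · rw [interior_Icc]
      exact fun w hw => (hd w ⟨hw.1, hw.2.trans_le hv'.2⟩).differentiableAt.differentiableWithinAt
    · rw [interior_Icc]
      intro w hw
      have hw' : w ∈ Ioo (0 : ℝ) 1 := ⟨hw.1, hw.2.trans_le hv'.2⟩
      rw [(hd w hw').deriv]
      have h1 := deriv_claspX_pos hw'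
      have h2 := slope_pos hw'
      have h3 := strictMonoOn_claspZ.monotoneOn hv (one_sub_mem_Icc (Ioo_subset_Icc_self hw'))
        (by linarith [hw.2])
      exact mul_nonpos_of_nonneg_of_nonpos (by positivity) (by linarith)
  · refine monotoneOn_of_deriv_nonneg (convex_Icc (1 - v) 1)
      (hfc.mono (Icc_subset_Icc_left hv'.1)) ?_ ?_ ⟨le_rfl, hv'.2⟩ ⟨h, hu.2⟩ h
    · rw [interior_Icc]
      exact fun w hw => (hd w ⟨hv'.1.trans_lt hw.1, hw.2⟩).differentiableAt.differentiableWithinAt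
    · rw [interior_Icc]
      intro w hw
      have hw' : w ∈ Ioo (0 : ℝ) 1 := ⟨hv'.1.trans_lt hw.1, hw.2⟩
      rw [(hd w hw').deriv]
      have h1 := deriv_claspX_pos hw'
      have h2 := slope_pos hw'
      have h3 := strictMonoOn_claspZ.monotoneOn (one_sub_mem_Icc (Ioo_subset_Icc_self hw')) hv
        (by linarith [hw.1])
      exact mul_nonneg (by positivity) (by linarith)

lemma one_le_claspH : 1 ≤ claspH := by
  have h := one_le_clasp_dist (u := 0) (v := 0) (by simp) (by simp)
  have h0 : 0 ≤ claspH := claspZ_nonneg (by simp)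
  simp only [claspX_zero, claspZ_zero] at h
  nlinarith

/-- Dividing `strut_sq` by `gap u` and using orthogonality writes `1 / gap u` as `claspX *
claspSlope` at `u` plus the same at `1 - u` plus `gap u`, all integrable. This makes the total strut
weight finite. -/
lemma intervalIntegrable_inv_gap : IntervalIntegrable (fun u => 1 / gap u) volume 0 1 := by
  have hs : IntervalIntegrable (fun u => claspSlope (1 - u)) volume 0 1 := by
    simpa using (intervalIntegrable_slope.comp_sub_left 1).symm
  have hX : ContinuousOn (fun u => claspX (1 - u)) (Icc 0 1) :=
    continuousOn_claspX.comp (by fun_prop) fun u hu => one_sub_mem_Icc hu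
  have h : IntervalIntegrable
      (fun u => claspX u * claspSlope u + claspX (1 - u) * claspSlope (1 - u) + gap u)
      volume 0 1 := by
    refine ((intervalIntegrable_slope.continuousOn_mul ?_).add (hs.continuousOn_mul ?_)).add
      (ContinuousOn.intervalIntegrable ?_)
    all_goals rw [uIcc_of_le zero_le_one]
    · exact continuousOn_claspX
    · exact hX
    · exact continuousOn_gap
  refine h.congr_uIoo ?_
  rw [uIoo_of_le zero_le_one]
  intro u hu
  have e1 := claspX_eq_gap_mul_slope hu
  have e2 := claspX_eq_gap_mul_slope (one_sub_mem_Ioo hu)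
  have e3 := strut_sq (Ioo_subset_Icc_self hu)
  have hg := gap_pos hu
  rw [gap_one_sub] at e2
  simp only
  rw [eq_div_iff hg.ne']
  calc _ = claspX u * (gap u * claspSlope u) + claspX (1 - u) * (gap u * claspSlope (1 - u))
        + gap u ^ 2 := by ring
    _ = 1 := by rw [← e1, ← e2]; linarith

/-! ### First variation of the length of a regular arc -/

lemma hasDerivAt_norm_add_smul {E : Type*} [NormedAddCommGroup E] [InnerProductSpace ℝ E]
    {a b : E} {r : ℝ} {T : E} (hr : 0 < r) (hT : ‖T‖ = 1)
    (ha : a = r • T) : HasDerivAt (fun t : ℝ => ‖a + t • b‖) (inner ℝ T b) 0 := by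
  have h1 : HasDerivAt (fun t : ℝ => a + t • b) b 0 := by
    simpa using ((hasDerivAt_id (0 : ℝ)).smul_const b).const_add a
  have hn : ‖a‖ = r := by rw [ha, norm_smul, hT, mul_one, Real.norm_of_nonneg hr.le]
  have h2 := h1.norm_sq.sqrt (by simp [hn, hr.ne'])
  simp only [Real.sqrt_sq (norm_nonneg _)] at h2
  refine h2.congr_deriv ?_
  rw [zero_smul, add_zero, hn, ha, real_inner_smul_left]
  field_simp

lemma intervalIntegrable_inner {E : Type*} [NormedAddCommGroup E] [InnerProductSpace ℝ E]
    {f ζ : ℝ → E} {a b : ℝ} (hf : IntervalIntegrable f volume a b) (hζ : Continuous ζ) :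
    IntervalIntegrable (fun u => inner ℝ (f u) (ζ u)) volume a b := by
  obtain ⟨C, hC⟩ := isCompact_uIcc.exists_bound_of_continuousOn (s := uIcc a b) hζ.continuousOn
  refine (hf.norm.mul_const C).mono_fun ?_ ?_
  · exact hf.def'.aestronglyMeasurable.inner hζ.aestronglyMeasurable
  · filter_upwards [ae_restrict_mem measurableSet_uIoc] with u hu
    refine (norm_inner_le_norm _ _).trans ?_
    have := hC u (uIoc_subset_uIcc hu)
    rw [norm_mul, norm_norm]
    gcongr
    exact this.trans (le_abs_self C)

lemma eVariationOn_le_of_dist_le {E : Type*} [PseudoMetricSpace E] {f : ℝ → E} {g : ℝ → ℝ}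
    {s : Set ℝ}
    (h : ∀ x ∈ s, ∀ y ∈ s, x ≤ y → dist (f y) (f x) ≤ dist (g y) (g x)) :
    eVariationOn f s ≤ eVariationOn g s := by
  refine iSup_le fun p => ?_
  refine le_trans (Finset.sum_le_sum fun i _ => ?_)
    (eVariationOn.sum_le (f := g) (n := p.1) p.2.2.1 p.2.2.2)
  rw [edist_dist, edist_dist]
  exact ENNReal.ofReal_le_ofReal
    (h _ (p.2.2.2 _) _ (p.2.2.2 _) (p.2.2.1 (Nat.le_succ i)))

section Length

variable {E : Type*} [NormedAddCommGroup E] [InnerProductSpace ℝ E] [CompleteSpace E]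

/-- The length of an arc is the integral of its speed; the velocity may be unbounded at the
endpoints of the parameter interval. -/
theorem eVariationOn_eq_integral_norm_deriv {f f' : ℝ → E} {a b : ℝ} (hab : a ≤ b)
    (hf : ContinuousOn f (Icc a b)) (hd : ∀ x ∈ Ioo a b, HasDerivAt f (f' x) x)
    (hc : ContinuousOn f' (Ioo a b)) (hi : IntervalIntegrable f' volume a b) :
    eVariationOn f (Icc a b) = ENNReal.ofReal (∫ x in a..b, ‖f' x‖) := by
  -- The variation function `V` below lies between chord length and `G` in the sense of increments:
  -- `dist (f y) (f x) ≤ V y - V x ≤ G y - G x`. Both outer difference quotients tend to `‖f' x‖`.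
  set G : ℝ → ℝ := fun x => ∫ w in a..x, ‖f' w‖ with hG
  have hsub : ∀ x ∈ Icc a b, ∀ y ∈ Icc a b, IntervalIntegrable f' volume x y := fun x hx y hy =>
    hi.mono_set (by rw [uIcc_of_le hab]; exact uIcc_subset_Icc hx hy)
  have ha : a ∈ Icc a b := ⟨le_rfl, hab⟩
  have hb : b ∈ Icc a b := ⟨hab, le_rfl⟩
  have hGd : ∀ x ∈ Icc a b, ∀ y ∈ Icc a b, G y - G x = ∫ w in x..y, ‖f' w‖ := fun x hx y hy =>
    intervalIntegral.integral_interval_sub_left (hsub a ha y hy).norm (hsub a ha x hx).norm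
  have hGm : MonotoneOn G (Icc a b) := fun x hx y hy hxy => by
    have := hGd x hx y hy
    have h2 : 0 ≤ ∫ w in x..y, ‖f' w‖ :=
      intervalIntegral.integral_nonneg hxy fun w _ => norm_nonneg _
    linarith
  have hfG : ∀ x ∈ Icc a b, ∀ y ∈ Icc a b, x ≤ y → dist (f y) (f x) ≤ G y - G x := by
    intro x hx y hy hxy
    have h1 : ∫ w in x..y, f' w = f y - f x :=
      intervalIntegral.integral_eq_sub_of_hasDerivAt_of_le hxy (hf.mono (Icc_subset_Icc hx.1 hy.2))
        (fun w hw => hd w ⟨hx.1.trans_lt hw.1, hw.2.trans_le hy.2⟩) (hsub x hx y hy)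
    rw [dist_eq_norm, ← h1, hGd x hx y hy]
    exact intervalIntegral.norm_integral_le_integral_norm hxy
  have hup : ∀ x ∈ Icc a b, ∀ y ∈ Icc a b, x ≤ y →
      eVariationOn f (Icc x y) ≤ ENNReal.ofReal (G y - G x) := by
    intro x hx y hy hxy
    have hs : Icc x y ⊆ Icc a b := Icc_subset_Icc hx.1 hy.2
    refine (eVariationOn_le_of_dist_le (g := G) fun w hw z hz hwz => ?_).trans ?_
    · rw [Real.dist_eq, abs_of_nonneg (sub_nonneg.2 (hGm (hs hw) (hs hz) hwz))]
      exact hfG w (hs hw) z (hs hz) hwz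
    · have := (hGm.mono hs).eVariationOn_eq (left_mem_Icc.2 hxy) (right_mem_Icc.2 hxy)
      rw [inter_self] at this
      exact this.le
  have hfin : ∀ x ∈ Icc a b, ∀ y ∈ Icc a b, x ≤ y → eVariationOn f (Icc x y) ≠ ⊤ :=
    fun x hx y hy hxy => ((hup x hx y hy hxy).trans_lt ENNReal.ofReal_lt_top).ne
  set V : ℝ → ℝ := fun x => (eVariationOn f (Icc a x)).toReal with hV
  have hVd : ∀ x ∈ Icc a b, ∀ y ∈ Icc a b, x ≤ y →
      V y - V x = (eVariationOn f (Icc x y)).toReal := by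
    intro x hx y hy hxy
    have h := eVariationOn.Icc_add_Icc f (s := univ) hx.1 hxy (mem_univ x)
    simp only [univ_inter] at h
    simp only [hV]
    rw [← h, ENNReal.toReal_add (hfin a ha x hx hx.1) (hfin x hx y hy hxy)]
    ring
  have hVG : ∀ x ∈ Icc a b, ∀ y ∈ Icc a b, x ≤ y → V y - V x ≤ G y - G x := by
    intro x hx y hy hxy
    rw [hVd x hx y hy hxy]
    exact ENNReal.toReal_le_of_le_ofReal (sub_nonneg.2 (hGm hx hy hxy)) (hup x hx y hy hxy)
  have hfV : ∀ x ∈ Icc a b, ∀ y ∈ Icc a b, x ≤ y → dist (f y) (f x) ≤ V y - V x := by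
    intro x hx y hy hxy
    rw [hVd x hx y hy hxy, dist_edist]
    exact ENNReal.toReal_mono (hfin x hx y hy hxy)
      (eVariationOn.edist_le f (right_mem_Icc.2 hxy) (left_mem_Icc.2 hxy))
  have hGc : ContinuousOn G (Icc a b) := by
    have := intervalIntegral.continuousOn_primitive_interval' hi.norm (a := a) (by simp)
    rwa [uIcc_of_le hab] at this
  have hVc : ContinuousOn V (Icc a b) := by
    intro x hx
    have h1 := hGc x hx
    rw [ContinuousWithinAt, tendsto_iff_dist_tendsto_zero] at h1 ⊢
    refine squeeze_zero' (Filter.Eventually.of_forall fun _ => dist_nonneg) ?_ h1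
    filter_upwards [self_mem_nhdsWithin] with y hy
    rcases le_total x y with h | h
    · have h2 := hVG x hx y hy h
      have h3 := hfV x hx y hy h
      have h4 : (0 : ℝ) ≤ dist (f y) (f x) := dist_nonneg
      rw [Real.dist_eq, Real.dist_eq, abs_of_nonneg (by linarith), abs_of_nonneg (by linarith)]
      exact h2
    · have h2 := hVG y hy x hx h
      have h3 := hfV y hy x hx h
      have h4 : (0 : ℝ) ≤ dist (f x) (f y) := dist_nonneg
      rw [Real.dist_eq, Real.dist_eq, abs_of_nonpos (by linarith), abs_of_nonpos (by linarith)]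
      linarith
  have hVder : ∀ x ∈ Ioo a b, HasDerivWithinAt V ‖f' x‖ (Ioi x) x := by
    intro x hx
    have hx' := Ioo_subset_Icc_self hx
    have hGder : HasDerivWithinAt G ‖f' x‖ (Ioi x) x := by
      refine HasDerivAt.hasDerivWithinAt ?_
      refine intervalIntegral.integral_hasDerivAt_right (hsub a ha x hx').norm
        (hc.norm.stronglyMeasurableAtFilter isOpen_Ioo x hx)
        (hc.norm.continuousAt (Ioo_mem_nhds hx.1 hx.2))
    have hfder : Filter.Tendsto (fun y => ‖slope f x y‖) (nhdsWithin x (Ioi x))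
        (nhds ‖f' x‖) := by
      have h := (hd x hx).hasDerivWithinAt (s := Ioi x)
      rw [hasDerivWithinAt_iff_tendsto_slope' (by simp)] at h
      exact h.norm
    rw [hasDerivWithinAt_iff_tendsto_slope' (by simp)] at hGder ⊢
    have hev : ∀ᶠ y in nhdsWithin x (Ioi x), y ∈ Ioo x b :=
      Ioo_mem_nhdsGT hx.2
    refine tendsto_of_tendsto_of_tendsto_of_le_of_le' hfder hGder ?_ ?_
    · filter_upwards [hev] with y hy
      have hp : 0 < y - x := sub_pos.2 hy.1
      have h := hfV x hx' y ⟨hx.1.le.trans hy.1.le, hy.2.le⟩ hy.1.le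
      rw [slope_def_module, slope_def_field, norm_smul, norm_inv, Real.norm_of_nonneg hp.le,
        ← dist_eq_norm, inv_mul_eq_div]
      gcongr
    · filter_upwards [hev] with y hy
      have hp : 0 < y - x := sub_pos.2 hy.1
      have h := hVG x hx' y ⟨hx.1.le.trans hy.1.le, hy.2.le⟩ hy.1.le
      rw [slope_def_field, slope_def_field]
      gcongr
  -- Only a right derivative in the interior and continuity up to the ends are available, and they
  -- suffice for the fundamental theorem.
  have hfinal : ∫ x in a..b, ‖f' x‖ = V b - V a :=
    intervalIntegral.integral_eq_sub_of_hasDeriv_right_of_le hab hVc hVder hi.norm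
  have hVa : V a = 0 := by simp [hV]
  rw [hfinal, hVa, sub_zero, ENNReal.ofReal_toReal (hfin a ha b hb hab)]

/-- First variation of the length of an arc with velocity `ρ T`, whose unit tangent vector `T` has
the integrable derivative `T'`. -/
theorem hasDerivAt_length {f T T' ζ ζ' : ℝ → E} {ρ : ℝ → ℝ}
    (hf : ContinuousOn f (Icc 0 1)) (hd : ∀ u ∈ Ioo (0 : ℝ) 1, HasDerivAt f (ρ u • T u) u)
    (hρ : ∀ u ∈ Ioo (0 : ℝ) 1, 0 < ρ u) (hρc : ContinuousOn ρ (Ioo 0 1))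
    (hρi : IntervalIntegrable ρ volume 0 1)
    (hT : ContinuousOn T (Icc 0 1)) (hT1 : ∀ u ∈ Ioo (0 : ℝ) 1, ‖T u‖ = 1)
    (hTd : ∀ u ∈ Ioo (0 : ℝ) 1, HasDerivAt T (T' u) u)
    (hTi : IntervalIntegrable T' volume 0 1)
    (hζ : ∀ u, HasDerivAt ζ (ζ' u) u) (hζ' : Continuous ζ') :
    (∀ t : ℝ, eVariationOn (fun u => f u + t • ζ u) (Icc 0 1) ≠ ⊤) ∧
    HasDerivAt (fun t : ℝ => (eVariationOn (fun u => f u + t • ζ u) (Icc 0 1)).toReal)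
      (inner ℝ (T 1) (ζ 1) - inner ℝ (T 0) (ζ 0) - ∫ u in (0 : ℝ)..1, inner ℝ (T' u) (ζ u)) 0 := by
  have hζc : Continuous ζ := continuous_iff_continuousAt.2 fun u => (hζ u).continuousAt
  have hT01 : ContinuousOn T (uIcc 0 1) := by rwa [uIcc_of_le zero_le_one]
  have hvi : IntervalIntegrable (fun u => ρ u • T u) volume 0 1 := hρi.smul_continuousOn hT01
  have hint : ∀ t : ℝ, IntervalIntegrable (fun u => ρ u • T u + t • ζ' u) volume 0 1 := fun t =>
    hvi.add ((hζ'.const_smul t).intervalIntegrable 0 1)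
  have hlen : ∀ t : ℝ, eVariationOn (fun u => f u + t • ζ u) (Icc 0 1) =
      ENNReal.ofReal (∫ u in (0 : ℝ)..1, ‖ρ u • T u + t • ζ' u‖) := by
    intro t
    refine eVariationOn_eq_integral_norm_deriv zero_le_one (hf.add (by fun_prop))
      (fun u hu => (hd u hu).add ((hζ u).const_smul t)) ?_ (hint t)
    exact (hρc.smul (hT.mono Ioo_subset_Icc_self)).add (by fun_prop)
  refine ⟨fun t => by rw [hlen t]; exact ENNReal.ofReal_ne_top, ?_⟩
  have hlen' : (fun t : ℝ => (eVariationOn (fun u => f u + t • ζ u) (Icc 0 1)).toReal) =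
      fun t => ∫ u in (0 : ℝ)..1, ‖ρ u • T u + t • ζ' u‖ := by
    funext t
    rw [hlen t, ENNReal.toReal_ofReal]
    exact intervalIntegral.integral_nonneg zero_le_one fun u _ => norm_nonneg _
  rw [hlen']
  have hTζ' : ContinuousOn (fun u => inner ℝ (T u) (ζ' u)) (uIcc 0 1) :=
    hT01.inner hζ'.continuousOn
  have hTζ : IntervalIntegrable (fun u => inner ℝ (T' u) (ζ u)) volume 0 1 :=
    intervalIntegrable_inner hTi hζc
  -- Integration by parts moves the derivative from the field to the tangent, leaving a functional
  -- of `ζ` alone that extends to continuous fields.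
  have hparts : ∫ u in (0 : ℝ)..1, inner ℝ (T u) (ζ' u) =
      inner ℝ (T 1) (ζ 1) - inner ℝ (T 0) (ζ 0) - ∫ u in (0 : ℝ)..1, inner ℝ (T' u) (ζ u) := by
    have h := intervalIntegral.integral_eq_sub_of_hasDerivAt_of_le zero_le_one
      (f := fun u => inner ℝ (T u) (ζ u))
      (f' := fun u => inner ℝ (T u) (ζ' u) + inner ℝ (T' u) (ζ u))
      (hT.inner hζc.continuousOn)
      (fun u hu => (hTd u hu).inner ℝ (hζ u)) (hTζ'.intervalIntegrable.add hTζ)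
    rw [intervalIntegral.integral_add hTζ'.intervalIntegrable hTζ] at h
    linarith
  rw [← hparts]
  have hae : ∀ᵐ u ∂(volume : Measure ℝ), u ∈ uIoc (0 : ℝ) 1 → u ∈ Ioo (0 : ℝ) 1 := by
    have : ∀ᵐ u ∂(volume : Measure ℝ), u ≠ 1 := by simp [ae_iff, measure_singleton]
    filter_upwards [this] with u hu hu'
    rw [uIoc_of_le zero_le_one] at hu'
    exact ⟨hu'.1, lt_of_le_of_ne hu'.2 hu⟩
  -- The integrand is Lipschitz in `t` with constant `‖ζ' u‖`, which does not involve the possibly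
  -- unbounded speed `ρ`.
  refine (intervalIntegral.hasDerivAt_integral_of_dominated_loc_of_lip
    (s := univ) (bound := fun u => ‖ζ' u‖)
    Filter.univ_mem ?_ ?_ ?_ ?_ ?_ ?_).2
  · exact Filter.Eventually.of_forall fun t => (hint t).norm.def'.aestronglyMeasurable
  · exact (hint 0).norm
  · exact hTζ'.intervalIntegrable.def'.aestronglyMeasurable
  · refine Filter.Eventually.of_forall fun u _ => ?_
    refine LipschitzOnWith.of_dist_le_mul fun t _ t' _ => ?_
    rw [Real.dist_eq]
    refine (abs_norm_sub_norm_le _ _).trans ?_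
    rw [add_sub_add_left_eq_sub, ← sub_smul, norm_smul, Real.dist_eq, mul_comm]
    simp
  · exact hζ'.norm.intervalIntegrable 0 1
  · filter_upwards [hae] with u hu hu'
    exact hasDerivAt_norm_add_smul (hρ u (hu hu')) (hT1 u (hu hu')) rfl

end Length

/-! ### One-sided derivative of a minimum over a compact space -/

/-- Danskin's theorem: the right derivative of a minimum over a compact space is the minimum of the
derivatives over the minimizers. -/
theorem hasDerivWithinAt_sInf_range {K : Type*} [TopologicalSpace K] [CompactSpace K] [Nonempty K]
    {φ : ℝ → K → ℝ} {D : K → ℝ} {C δ : ℝ} (hφ : Continuous (φ 0)) (hD : Continuous D)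
    (hδ : 0 < δ) (h : ∀ t, 0 ≤ t → t ≤ δ → ∀ k, |φ t k - φ 0 k - t * D k| ≤ C * t ^ 2) :
    ∃ a, HasDerivWithinAt (fun t => sInf (range (φ t))) a (Ici 0) 0 ∧
      (∃ k, (∀ k', φ 0 k ≤ φ 0 k') ∧ a = D k) ∧
      ∀ k, (∀ k', φ 0 k ≤ φ 0 k') → a ≤ D k := by
  obtain ⟨k₁, -, hk₁⟩ := isCompact_univ.exists_isMinOn (univ_nonempty (α := K)) hφ.continuousOn
  have hk₁' : ∀ k, φ 0 k₁ ≤ φ 0 k := fun k => hk₁ (mem_univ k)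
  set m := φ 0 k₁ with hm
  have hAc : IsCompact {k | φ 0 k ≤ m} := (isClosed_le hφ continuous_const).isCompact
  obtain ⟨k₀, hk₀, hk₀'⟩ := hAc.exists_isMinOn ⟨k₁, le_refl m⟩ hD.continuousOn
  have hk₀m : φ 0 k₀ = m := le_antisymm hk₀ (hk₁' k₀)
  have hmin : ∀ k, φ 0 k ≤ m → D k₀ ≤ D k := fun k hk => hk₀' hk
  refine ⟨D k₀, ?_, ⟨k₀, fun k' => hk₀m.le.trans (hk₁' k'), rfl⟩, fun k hk => hmin k (hk k₁)⟩
  obtain ⟨M, hM⟩ := isCompact_univ.exists_bound_of_continuousOn (hD.continuousOn (s := univ))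
  have hM' : ∀ k, -M ≤ D k := fun k => neg_le_of_abs_le (hM k (mem_univ k))
  have hM0 : 0 ≤ M := (norm_nonneg _).trans (hM k₀ (mem_univ _))
  have hlow : ∀ t, 0 ≤ t → t ≤ δ → ∀ k, φ 0 k + t * D k - C * t ^ 2 ≤ φ t k := fun t h0 h1 k => by
    have := (abs_le.1 (h t h0 h1 k)).1
    linarith
  have hbdd : ∀ t, 0 ≤ t → t ≤ δ → BddBelow (range (φ t)) := fun t h0 h1 => by
    refine ⟨m - t * M - C * t ^ 2, ?_⟩
    rintro _ ⟨k, rfl⟩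
    have := hlow t h0 h1 k
    have := hk₁' k
    nlinarith [hM' k]
  have hg0 : sInf (range (φ 0)) = m :=
    IsLeast.csInf_eq ⟨⟨k₁, rfl⟩, by rintro _ ⟨k, rfl⟩; exact hk₁' k⟩
  have hC : 0 ≤ C := by
    have := (abs_nonneg _).trans (h δ hδ.le le_rfl k₀)
    exact nonneg_of_mul_nonneg_left this (by positivity)
  rw [hasDerivWithinAt_iff_isLittleO, Asymptotics.isLittleO_iff]
  intro ε hε
  -- The points where `D` is definitely below `D k₀` form a compact set without minimizers, so `φ 0`
  -- exceeds its minimum there by a uniform margin `η`.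
  obtain ⟨η, hη, hηk⟩ : ∃ η > 0, ∀ k, D k ≤ D k₀ - ε / 2 → m + η ≤ φ 0 k := by
    have hUc : IsCompact {k | D k ≤ D k₀ - ε / 2} := (isClosed_le hD continuous_const).isCompact
    rcases {k | D k ≤ D k₀ - ε / 2}.eq_empty_or_nonempty with he | hne
    · refine ⟨1, one_pos, fun k hk => ?_⟩
      have : k ∈ {k | D k ≤ D k₀ - ε / 2} := hk
      rw [he] at this
      exact this.elim
    · obtain ⟨k₂, hk₂, hk₂'⟩ := hUc.exists_isMinOn hne hφ.continuousOn
      refine ⟨φ 0 k₂ - m, ?_, fun k hk => ?_⟩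
      · by_contra hcon
        have h1 := hmin k₂ (by linarith)
        have h2 : D k₂ ≤ D k₀ - ε / 2 := hk₂
        linarith
      · have : φ 0 k₂ ≤ φ 0 k := hk₂' hk
        linarith
  have hden : 0 < M + |D k₀| + 1 := by positivity
  -- The second bound keeps the linear terms from using up the margin `η`; the third makes the
  -- quadratic error at most `ε / 2 * t`.
  set δ' := min δ (min (η / (M + |D k₀| + 1)) (ε / 2 / (C + 1))) with hδ'
  have hδ'0 : 0 < δ' := by positivity
  have hmem : ∀ᶠ t in nhdsWithin (0 : ℝ) (Ici 0), t ∈ Ico 0 δ' := Ico_mem_nhdsGE hδ'0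
  filter_upwards [hmem] with t ht
  have ht0 := ht.1
  have ht1 : t ≤ δ := ht.2.le.trans (min_le_left _ _)
  have ht2 : t * (M + |D k₀| + 1) ≤ η := by
    rw [← le_div_iff₀ hden]
    exact ht.2.le.trans ((min_le_right _ _).trans (min_le_left _ _))
  have ht3 : t * (C + 1) ≤ ε / 2 := by
    rw [← le_div_iff₀ (by positivity)]
    exact ht.2.le.trans ((min_le_right _ _).trans (min_le_right _ _))
  have hC2 : C * t ^ 2 ≤ ε / 2 * t := by nlinarith
  have hub : sInf (range (φ t)) ≤ m + t * D k₀ + ε / 2 * t := by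
    refine (csInf_le (hbdd t ht0 ht1) ⟨k₀, rfl⟩).trans ?_
    have := (abs_le.1 (h t ht0 ht1 k₀)).2
    linarith
  have hlb : m + t * D k₀ - ε * t ≤ sInf (range (φ t)) := by
    refine le_csInf (range_nonempty _) ?_
    rintro _ ⟨k, rfl⟩
    refine le_trans ?_ (hlow t ht0 ht1 k)
    rcases le_total (D k) (D k₀ - ε / 2) with hk | hk
    · have h1 := hηk k hk
      have h2 := hM' k
      have h3 := le_abs_self (D k₀)
      nlinarith
    · have h1 := hk₁' k
      nlinarith
  rw [hg0, sub_zero, smul_eq_mul, Real.norm_eq_abs, Real.norm_eq_abs, abs_of_nonneg ht0, abs_le]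
  constructor <;> nlinarith

/-- Second-order estimate for the distance of two points that move uniformly. -/
lemma abs_norm_add_smul_sub_le {E : Type*} [NormedAddCommGroup E] [InnerProductSpace ℝ E]
    {a b : E} {t : ℝ} (ha : 1 ≤ ‖a‖) (ht : |t| * ‖b‖ ≤ 1 / 2) :
    |‖a + t • b‖ - ‖a‖ - t * (inner ℝ a b / ‖a‖)| ≤ ‖b‖ ^ 2 * t ^ 2 := by
  have ha0 : 0 < ‖a‖ := one_pos.trans_le ha
  set p := inner ℝ a b / ‖a‖ with hp
  have hpb : |p| ≤ ‖b‖ := by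
    rw [hp, abs_div, abs_of_pos ha0, div_le_iff₀ ha0, mul_comm]
    exact abs_real_inner_le_norm a b
  have hpa : inner ℝ a b = p * ‖a‖ := by rw [hp]; field_simp
  have hsq : ‖a + t • b‖ ^ 2 = ‖a‖ ^ 2 + 2 * t * (p * ‖a‖) + t ^ 2 * ‖b‖ ^ 2 := by
    rw [norm_add_sq_real, real_inner_smul_right, hpa, norm_smul, mul_pow, Real.norm_eq_abs, sq_abs]
    ring
  set N := ‖a + t • b‖ with hN
  have hN0 : 0 ≤ N := norm_nonneg _
  have hpb2 : p ^ 2 ≤ ‖b‖ ^ 2 := sq_le_sq.2 (by rwa [abs_norm])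
  -- Difference of squares. The second factor is at least 1 because `N` and `‖a‖ + t * p` are each
  -- at least `1/2`, so the first inherits the quadratic bound.
  have hfac : (N - (‖a‖ + t * p)) * (N + (‖a‖ + t * p)) = t ^ 2 * (‖b‖ ^ 2 - p ^ 2) := by
    ring_nf
    ring_nf at hsq
    linarith
  have htp : |t * p| ≤ 1 / 2 := by
    rw [abs_mul]
    exact (mul_le_mul_of_nonneg_left hpb (abs_nonneg t)).trans ht
  have hq : 1 / 2 ≤ ‖a‖ + t * p := by linarith [neg_le_of_abs_le htp]
  have hge : ‖a‖ + t * p ≤ N := by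
    have := mul_nonneg (sq_nonneg t) (sub_nonneg.2 hpb2)
    rw [← hfac] at this
    exact sub_nonneg.1 (nonneg_of_mul_nonneg_left this (by linarith))
  rw [show N - ‖a‖ - t * p = N - (‖a‖ + t * p) by ring, abs_of_nonneg (by linarith)]
  nlinarith [sq_nonneg (t * p), mul_nonneg (sub_nonneg.2 hge) (sub_nonneg.2 hq)]

/-! ### Points of three-space by coordinates -/

lemma continuousOn_vec {f g h : ℝ → ℝ} {s : Set ℝ} (hf : ContinuousOn f s) (hg : ContinuousOn g s)
    (hh : ContinuousOn h s) : ContinuousOn (fun t => (!₂[f t, g t, h t] : E3)) s := by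
  refine (PiLp.continuous_toLp 2 _).comp_continuousOn (continuousOn_pi.2 fun i => ?_)
  fin_cases i
  · exact hf
  · exact hg
  · exact hh

lemma hasDerivAt_vec {f g h : ℝ → ℝ} {f' g' h' t : ℝ} (hf : HasDerivAt f f' t)
    (hg : HasDerivAt g g' t) (hh : HasDerivAt h h' t) :
    HasDerivAt (fun t => (!₂[f t, g t, h t] : E3)) !₂[f', g', h'] t := by
  have hp : HasDerivAt (fun t => (![f t, g t, h t] : Fin 3 → ℝ)) ![f', g', h'] t := by
    refine hasDerivAt_pi.2 fun i => ?_
    fin_cases i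
    · exact hf
    · exact hg
    · exact hh
  exact ((PiLp.continuousLinearEquiv 2 ℝ (fun _ : Fin 3 => ℝ)).symm.hasFDerivAt).comp_hasDerivAt
    t hp

lemma norm_vec_sq (q : E3) : ‖q‖ ^ 2 = q 0 ^ 2 + q 1 ^ 2 + q 2 ^ 2 := by
  simp [EuclideanSpace.norm_sq_eq, Fin.sum_univ_three]

lemma inner_vec (p q : E3) : inner ℝ p q = p 0 * q 0 + p 1 * q 1 + p 2 * q 2 := by
  simp [PiLp.inner_apply, Fin.sum_univ_three, mul_comm]

lemma vec_ext {p q : E3} (h0 : p 0 = q 0) (h1 : p 1 = q 1) (h2 : p 2 = q 2) : p = q := by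
  ext i
  fin_cases i
  · exact h0
  · exact h1
  · exact h2

lemma continuousOn_Icc_append {E : Type*} [TopologicalSpace E] {f : ℝ → E} {a b c : ℝ}
    (hab : a ≤ b) (hbc : b ≤ c) (h₁ : ContinuousOn f (Icc a b)) (h₂ : ContinuousOn f (Icc b c)) :
    ContinuousOn f (Icc a c) := by
  rw [← Icc_union_Icc_eq_Icc hab hbc]
  exact h₁.union_of_isClosed h₂ isClosed_Icc isClosed_Icc

lemma strictMonoOn_Icc_append {f : ℝ → ℝ} {a b c : ℝ} (hab : a ≤ b) (hbc : b ≤ c)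
    (h₁ : StrictMonoOn f (Icc a b)) (h₂ : StrictMonoOn f (Icc b c)) :
    StrictMonoOn f (Icc a c) := by
  rw [← Icc_union_Icc_eq_Icc hab hbc]
  exact h₁.union h₂ (isGreatest_Icc hab) (isLeast_Icc hbc)

/-! ### The half of `β` -/

lemma claspH_pos : 0 < claspH := one_pos.trans_le one_le_claspH

lemma ceil_pos {d : ℝ} (hd : 0 < d) : 0 < ceil d := by
  have := claspH_pos
  unfold ceil
  positivity

lemma halfX_of_mem_zero_one {s : ℝ} (hs : s ∈ Icc (0 : ℝ) 1) : halfX s = 1 := if_pos hs.2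

lemma halfX_of_mem_one_two {s : ℝ} (hs : s ∈ Icc (1 : ℝ) 2) : halfX s = claspX (2 - s) := by
  rcases hs.1.eq_or_lt with rfl | h
  · rw [halfX, if_pos le_rfl, show (2 : ℝ) - 1 = 1 by norm_num, claspX_one]
  · rw [halfX, if_neg h.not_ge, if_pos hs.2]

lemma halfX_of_mem_two_three {s : ℝ} (hs : s ∈ Icc (2 : ℝ) 3) : halfX s = -claspX (s - 2) := by
  rcases hs.1.eq_or_lt with rfl | h
  · rw [halfX_of_mem_one_two (by norm_num), sub_self, claspX_zero, neg_zero]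
  · rw [halfX, if_neg (by linarith), if_neg h.not_ge, if_pos hs.2]

lemma halfX_of_mem_three_four {s : ℝ} (hs : s ∈ Icc (3 : ℝ) 4) : halfX s = -claspX (4 - s) := by
  rcases hs.1.eq_or_lt with rfl | h
  · rw [halfX_of_mem_two_three (by norm_num)]
    norm_num
  · rw [halfX, if_neg (by linarith), if_neg (by linarith), if_neg h.not_ge]

lemma halfZ_of_mem_zero_one (d : ℝ) {s : ℝ} (hs : s ∈ Icc (0 : ℝ) 1) :
    halfZ d s = -ceil d + s * d := if_pos hs.2

lemma halfZ_of_mem_one_two (d : ℝ) {s : ℝ} (hs : s ∈ Icc (1 : ℝ) 2) :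
    halfZ d s = -claspH / 2 - claspZ (2 - s) := by
  rcases hs.1.eq_or_lt with rfl | h
  · rw [halfZ, if_pos le_rfl, show (2 : ℝ) - 1 = 1 by norm_num, ceil, claspH]
    ring
  · rw [halfZ, if_neg h.not_ge, if_pos hs.2]

lemma halfZ_of_mem_two_three (d : ℝ) {s : ℝ} (hs : s ∈ Icc (2 : ℝ) 3) :
    halfZ d s = -claspH / 2 + claspZ (s - 2) := by
  rcases hs.1.eq_or_lt with rfl | h
  · rw [halfZ_of_mem_one_two d (by norm_num), sub_self, claspZ_zero]
    ring
  · rw [halfZ, if_neg (by linarith), if_neg h.not_ge, if_pos hs.2]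

lemma halfZ_of_mem_three_four (d : ℝ) {s : ℝ} (hs : s ∈ Icc (3 : ℝ) 4) :
    halfZ d s = 3 * claspH / 2 - claspZ (4 - s) := by
  rcases hs.1.eq_or_lt with rfl | h
  · rw [halfZ_of_mem_two_three d (by norm_num), show (3 : ℝ) - 2 = 1 by norm_num,
      show (4 : ℝ) - 3 = 1 by norm_num, claspH]
    ring
  · rw [halfZ, if_neg (by linarith), if_neg (by linarith), if_neg h.not_ge]

lemma halfX_two : halfX 2 = 0 := by
  rw [halfX_of_mem_one_two (by norm_num), sub_self, claspX_zero]

lemma halfX_four : halfX 4 = 0 := by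
  rw [halfX_of_mem_three_four (by norm_num), sub_self, claspX_zero, neg_zero]

lemma halfZ_two (d : ℝ) : halfZ d 2 = -claspH / 2 := by
  rw [halfZ_of_mem_one_two d (by norm_num), sub_self, claspZ_zero, sub_zero]

lemma halfZ_three (d : ℝ) : halfZ d 3 = claspH / 2 := by
  rw [halfZ_of_mem_three_four d (by norm_num), show (4 : ℝ) - 3 = 1 by norm_num, claspH]
  ring

lemma halfZ_four (d : ℝ) : halfZ d 4 = 3 * claspH / 2 := by
  rw [halfZ_of_mem_three_four d (by norm_num), sub_self, claspZ_zero, sub_zero]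

lemma halfZ_zero (d : ℝ) : halfZ d 0 = -ceil d := by
  rw [halfZ_of_mem_zero_one d (by norm_num), zero_mul, add_zero]

lemma halfX_pos {s : ℝ} (hs : s ∈ Ico (0 : ℝ) 2) : 0 < halfX s := by
  rcases le_total s 1 with h | h
  · rw [halfX_of_mem_zero_one ⟨hs.1, h⟩]
    exact one_pos
  · rw [halfX_of_mem_one_two ⟨h, hs.2.le⟩]
    exact claspX_pos ⟨by linarith [hs.2], by linarith⟩

lemma halfX_neg {s : ℝ} (hs : s ∈ Ioo (2 : ℝ) 4) : halfX s < 0 := by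
  rcases le_total s 3 with h | h
  · rw [halfX_of_mem_two_three ⟨hs.1.le, h⟩]
    exact neg_neg_of_pos (claspX_pos ⟨by linarith [hs.1], by linarith⟩)
  · rw [halfX_of_mem_three_four ⟨h, hs.2.le⟩]
    exact neg_neg_of_pos (claspX_pos ⟨by linarith [hs.2], by linarith⟩)

lemma continuousOn_halfX : ContinuousOn halfX (Icc 0 4) := by
  refine continuousOn_Icc_append (b := 3) (by norm_num) (by norm_num)
    (continuousOn_Icc_append (b := 2) (by norm_num) (by norm_num)
      (continuousOn_Icc_append (b := 1) (by norm_num) (by norm_num) ?_ ?_) ?_) ?_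
  · exact continuousOn_const.congr fun s hs => halfX_of_mem_zero_one hs
  · exact (continuousOn_claspX.comp (by fun_prop : ContinuousOn (fun s : ℝ => 2 - s) _)
      fun s hs => ⟨by linarith [hs.2], by linarith [hs.1]⟩).congr
      fun s hs => halfX_of_mem_one_two hs
  · exact (continuousOn_claspX.comp (by fun_prop : ContinuousOn (fun s : ℝ => s - 2) _)
      fun s hs => ⟨by linarith [hs.1], by linarith [hs.2]⟩).neg.congr
      fun s hs => halfX_of_mem_two_three hs
  · exact (continuousOn_claspX.comp (by fun_prop : ContinuousOn (fun s : ℝ => 4 - s) _)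
      fun s hs => ⟨by linarith [hs.2], by linarith [hs.1]⟩).neg.congr
      fun s hs => halfX_of_mem_three_four hs

lemma continuousOn_halfZ (d : ℝ) : ContinuousOn (halfZ d) (Icc 0 4) := by
  refine continuousOn_Icc_append (b := 3) (by norm_num) (by norm_num)
    (continuousOn_Icc_append (b := 2) (by norm_num) (by norm_num)
      (continuousOn_Icc_append (b := 1) (by norm_num) (by norm_num) ?_ ?_) ?_) ?_
  · exact (by fun_prop : ContinuousOn (fun s => -ceil d + s * d) _).congr
      fun s hs => halfZ_of_mem_zero_one d hs
  · exact (continuousOn_const.sub (continuousOn_claspZ.comp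
      (by fun_prop : ContinuousOn (fun s : ℝ => 2 - s) _)
      fun s hs => ⟨by linarith [hs.2], by linarith [hs.1]⟩)).congr
      fun s hs => halfZ_of_mem_one_two d hs
  · exact (continuousOn_const.add (continuousOn_claspZ.comp
      (by fun_prop : ContinuousOn (fun s : ℝ => s - 2) _)
      fun s hs => ⟨by linarith [hs.1], by linarith [hs.2]⟩)).congr
      fun s hs => halfZ_of_mem_two_three d hs
  · exact (continuousOn_const.sub (continuousOn_claspZ.comp
      (by fun_prop : ContinuousOn (fun s : ℝ => 4 - s) _)
      fun s hs => ⟨by linarith [hs.2], by linarith [hs.1]⟩)).congr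
      fun s hs => halfZ_of_mem_three_four d hs

lemma strictMonoOn_halfZ {d : ℝ} (hd : 0 < d) : StrictMonoOn (halfZ d) (Icc 0 4) := by
  refine strictMonoOn_Icc_append (b := 3) (by norm_num) (by norm_num)
    (strictMonoOn_Icc_append (b := 2) (by norm_num) (by norm_num)
      (strictMonoOn_Icc_append (b := 1) (by norm_num) (by norm_num) ?_ ?_) ?_) ?_
  · intro s hs t ht hst
    rw [halfZ_of_mem_zero_one d hs, halfZ_of_mem_zero_one d ht]
    nlinarith
  · intro s hs t ht hst
    rw [halfZ_of_mem_one_two d hs, halfZ_of_mem_one_two d ht]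
    have := strictMonoOn_claspZ (a := 2 - t) (b := 2 - s) ⟨by linarith [ht.2], by linarith [ht.1]⟩
      ⟨by linarith [hs.2], by linarith [hs.1]⟩ (by linarith)
    linarith
  · intro s hs t ht hst
    rw [halfZ_of_mem_two_three d hs, halfZ_of_mem_two_three d ht]
    have := strictMonoOn_claspZ (a := s - 2) (b := t - 2) ⟨by linarith [hs.1], by linarith [hs.2]⟩
      ⟨by linarith [ht.1], by linarith [ht.2]⟩ (by linarith)
    linarith
  · intro s hs t ht hst
    rw [halfZ_of_mem_three_four d hs, halfZ_of_mem_three_four d ht]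
    have := strictMonoOn_claspZ (a := 4 - t) (b := 4 - s) ⟨by linarith [ht.2], by linarith [ht.1]⟩
      ⟨by linarith [hs.2], by linarith [hs.1]⟩ (by linarith)
    linarith

lemma halfZ_mem {d : ℝ} (hd : 0 < d) {s : ℝ} (hs : s ∈ Icc (0 : ℝ) 4) :
    halfZ d s ∈ Icc (-ceil d) (3 * claspH / 2) := by
  have h := (strictMonoOn_halfZ hd).monotoneOn
  rw [← halfZ_zero, ← halfZ_four d]
  exact ⟨h (by norm_num) hs hs.1, h hs (by norm_num) hs.2⟩

lemma half_cases {d : ℝ} {s : ℝ} (hs : s ∈ Icc (0 : ℝ) 4) :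
    halfX s ^ 2 = 1 ∨ ∃ u ∈ Icc (0 : ℝ) 1, halfX s ^ 2 = claspX u ^ 2 ∧
      (halfZ d s = -claspH / 2 - claspZ u ∨ halfZ d s = -claspH / 2 + claspZ u ∨
        halfZ d s = 3 * claspH / 2 - claspZ u) := by
  rcases le_total s 1 with h1 | h1
  · left
    rw [halfX_of_mem_zero_one ⟨hs.1, h1⟩, one_pow]
  right
  rcases le_total s 2 with h2 | h2
  · exact ⟨2 - s, ⟨by linarith, by linarith⟩, by rw [halfX_of_mem_one_two ⟨h1, h2⟩],
      Or.inl (halfZ_of_mem_one_two d ⟨h1, h2⟩)⟩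
  rcases le_total s 3 with h3 | h3
  · exact ⟨s - 2, ⟨by linarith, by linarith⟩, by rw [halfX_of_mem_two_three ⟨h2, h3⟩, neg_sq],
      Or.inr (Or.inl (halfZ_of_mem_two_three d ⟨h2, h3⟩))⟩
  · exact ⟨4 - s, ⟨by linarith [hs.2], by linarith⟩,
      by rw [halfX_of_mem_three_four ⟨h3, hs.2⟩, neg_sq],
      Or.inr (Or.inr (halfZ_of_mem_three_four d ⟨h3, hs.2⟩))⟩

/-- The heights add because `γ` is upside down. A straight segment is already at distance 1 from the
axis plane of the other component; two clasp arcs are at least as far apart vertically as if they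
faced each other in one clasp, where `one_le_clasp_dist` applies. -/
lemma one_le_half_dist (d : ℝ) {s t : ℝ} (hs : s ∈ Icc (0 : ℝ) 4) (ht : t ∈ Icc (0 : ℝ) 4) :
    1 ≤ halfX s ^ 2 + halfX t ^ 2 + (halfZ d s + halfZ d t) ^ 2 := by
  rcases half_cases (d := d) hs with h | ⟨u, hu, hx, hz⟩
  · nlinarith [sq_nonneg (halfX t), sq_nonneg (halfZ d s + halfZ d t)]
  rcases half_cases (d := d) ht with h | ⟨v, hv, hy, hw⟩
  · nlinarith [sq_nonneg (halfX s), sq_nonneg (halfZ d s + halfZ d t)]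
  have key := one_le_clasp_dist hu hv
  have u0 := claspZ_nonneg hu
  have v0 := claspZ_nonneg hv
  have u1 := claspZ_le hu
  have v1 := claspZ_le hv
  have hH := claspH_pos
  rw [hx, hy]
  have : |claspH - claspZ u - claspZ v| ≤ |halfZ d s + halfZ d t| := by
    rcases hz with hz | hz | hz <;> rcases hw with hw | hw | hw <;> rw [hz, hw, abs_le] <;>
      constructor <;>
      first
      | (refine le_trans ?_ (le_abs_self _); linarith)
      | (refine le_trans ?_ (neg_le_abs _); linarith)
      | (refine (neg_le_neg (le_abs_self _)).trans ?_; linarith)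
      | (refine (neg_le_neg (neg_le_abs _)).trans ?_; linarith)
  have := sq_le_sq.2 this
  linarith

/-! ### The components -/

/-- The arc `beta` with real parameter. -/
def betaR (d s : ℝ) : E3 :=
  if s ≤ 1 / 2 then !₂[halfX (8 * s), 0, halfZ d (8 * s)]
  else !₂[-halfX (8 * (1 - s)), 0, halfZ d (8 * (1 - s))]

lemma beta_eq (d : ℝ) (s : I) : beta d s = betaR d s := rfl

lemma betaR_left (d : ℝ) {s : ℝ} (hs : s ≤ 1 / 2) :
    betaR d s = !₂[halfX (8 * s), 0, halfZ d (8 * s)] := if_pos hs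

lemma betaR_right (d : ℝ) {s : ℝ} (hs : 1 / 2 ≤ s) :
    betaR d s = !₂[-halfX (8 * (1 - s)), 0, halfZ d (8 * (1 - s))] := by
  rcases hs.eq_or_lt with rfl | h
  · rw [betaR_left d le_rfl]
    norm_num [halfX_four]
  · exact if_neg h.not_ge

lemma continuousOn_betaR (d : ℝ) : ContinuousOn (betaR d) (Icc 0 1) := by
  refine continuousOn_Icc_append (b := 1 / 2) (by norm_num) (by norm_num) ?_ ?_
  · refine (continuousOn_vec (continuousOn_halfX.comp
      (by fun_prop : ContinuousOn (fun s : ℝ => 8 * s) _) fun s hs => ?_) continuousOn_const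
      ((continuousOn_halfZ d).comp (by fun_prop : ContinuousOn (fun s : ℝ => 8 * s) _)
        fun s hs => ?_)).congr fun s hs => betaR_left d hs.2
    all_goals exact ⟨by linarith [hs.1], by linarith [hs.2]⟩
  · refine (continuousOn_vec (continuousOn_halfX.comp
      (by fun_prop : ContinuousOn (fun s : ℝ => 8 * (1 - s)) _) fun s hs => ?_).neg
      continuousOn_const
      ((continuousOn_halfZ d).comp (by fun_prop : ContinuousOn (fun s : ℝ => 8 * (1 - s)) _)
        fun s hs => ?_)).congr fun s hs => betaR_right d hs.1
    all_goals exact ⟨by linarith [hs.2], by linarith [hs.1]⟩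

lemma continuous_beta (d : ℝ) : Continuous (beta d) :=
  continuousOn_iff_continuous_domRestrict.1 (continuousOn_betaR d)

/-- The rotation `(x₁, x₂, z) ↦ (x₂, x₁, -z)`. -/
def flip : E3 →ₗᵢ[ℝ] E3 where
  toFun q := !₂[q 1, q 0, -q 2]
  map_add' p q := by
    refine vec_ext ?_ ?_ ?_ <;> simp
    ring
  map_smul' c q := by
    refine vec_ext ?_ ?_ ?_ <;> simp
  norm_map' q := by
    rw [← sq_eq_sq₀ (norm_nonneg _) (norm_nonneg _), norm_vec_sq, norm_vec_sq]
    simp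
    ring

lemma flip_apply (q : E3) : flip q = !₂[q 1, q 0, -q 2] := rfl

lemma gamma_eq (d : ℝ) (s : I) : gamma d s = flip (beta d s) := rfl

lemma continuous_gamma (d : ℝ) : Continuous (gamma d) :=
  flip.continuous.comp (continuous_beta d)

/-- Each point of `β` lies on the half `(halfX, halfZ)` up to a sign. -/
lemma exists_beta_eq (d : ℝ) (s : I) :
    ∃ a ∈ Icc (0 : ℝ) 4, (beta d s 0 = halfX a ∨ beta d s 0 = -halfX a) ∧ beta d s 1 = 0 ∧
      beta d s 2 = halfZ d a := by
  obtain ⟨h0, h1⟩ := s.2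
  rw [beta_eq]
  rcases le_total (s : ℝ) (1 / 2) with h | h
  · refine ⟨8 * s, ⟨by linarith, by linarith⟩, ?_⟩
    rw [betaR_left d h]
    simp
  · refine ⟨8 * (1 - s), ⟨by linarith, by linarith⟩, ?_⟩
    rw [betaR_right d h]
    simp

lemma abs_beta_two_le {d : ℝ} (hd : 0 < d) (s : I) : |beta d s 2| ≤ ceil d := by
  obtain ⟨a, ha, -, -, h⟩ := exists_beta_eq d s
  have := halfZ_mem hd ha
  rw [h, abs_le]
  refine ⟨this.1, this.2.trans ?_⟩
  unfold ceil
  linarith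

lemma one_le_dist_beta_gamma (d : ℝ) (s t : I) : 1 ≤ dist (beta d s) (gamma d t) := by
  obtain ⟨a, ha, hx, hx1, hz⟩ := exists_beta_eq d s
  obtain ⟨b, hb, hy, hy1, hw⟩ := exists_beta_eq d t
  have key := one_le_half_dist d ha hb
  rw [dist_eq_norm]
  refine (one_le_sq_iff₀ (norm_nonneg _)).1 ?_
  rw [norm_vec_sq]
  have ex : beta d s 0 ^ 2 = halfX a ^ 2 := by
    rcases hx with h | h <;> rw [h]
    rw [neg_sq]
  have ey : beta d t 0 ^ 2 = halfX b ^ 2 := by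
    rcases hy with h | h <;> rw [h]
    rw [neg_sq]
  simp only [gamma, PiLp.sub_apply, Matrix.cons_val, hx1, hy1, hz, hw, sub_zero,
    zero_sub, neg_sq, sub_neg_eq_add, ex, ey]
  exact key

/-- Height is strictly monotone on each half, so a double point pairs mirror-image parameters and
lies on the axis. The only axis points of a half are `p` and the tip, and at the tip the two
parameters coincide. -/
lemma beta_eq_beta {d : ℝ} (hd : 0 < d) {s t : I} (hst : s ≠ t) (h : beta d s = beta d t) :
    beta d s = !₂[0, 0, -claspH / 2] := by
  wlog hle : (s : ℝ) ≤ t generalizing s t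
  · rw [h]
    exact this hst.symm h.symm (le_of_not_ge hle)
  have hne : (s : ℝ) ≠ t := fun h => hst (Subtype.ext h)
  have hs0 := s.2.1
  have ht1 := t.2.2
  have inj := (strictMonoOn_halfZ hd).injOn
  have h0 : beta d s 0 = beta d t 0 := by rw [h]
  have h2 : beta d s 2 = beta d t 2 := by rw [h]
  rw [beta_eq] at h0 h2 ⊢
  rw [beta_eq] at h0 h2
  rcases le_total (t : ℝ) (1 / 2) with ht | ht
  · rw [betaR_left d ht, betaR_left d (hle.trans ht)] at h2
    simp only [Matrix.cons_val] at h2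
    have := inj ⟨by linarith, by linarith⟩ ⟨by linarith, by linarith⟩ h2
    exact absurd (by linarith) hne
  rcases le_total (s : ℝ) (1 / 2) with hs | hs
  · rw [betaR_right d ht, betaR_left d hs] at h0 h2
    simp only [Matrix.cons_val] at h0 h2
    have e := inj ⟨by linarith, by linarith⟩ ⟨by linarith, by linarith⟩ h2
    rw [← e] at h0
    have hx : halfX (8 * s) = 0 := by linarith
    have h4 : (8 * s : ℝ) ≠ 4 := fun h4 => hne (by linarith)
    have h2' : (8 * s : ℝ) = 2 := by
      rcases lt_trichotomy (8 * s : ℝ) 2 with hl | hl | hl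
      · exact absurd hx (halfX_pos ⟨by linarith, hl⟩).ne'
      · exact hl
      · exact absurd hx (halfX_neg ⟨hl, lt_of_le_of_ne (by linarith) h4⟩).ne
    rw [betaR_left d hs, h2', halfX_two, halfZ_two]
  · rw [betaR_right d ht, betaR_right d hs] at h2
    simp only [Matrix.cons_val] at h2
    have := inj ⟨by linarith, by linarith⟩ ⟨by linarith, by linarith⟩ h2
    exact absurd (by linarith) hne

lemma existsUnique_self_intersection {d : ℝ} (hd : 0 < d) (i : Fin 2) :
    ∃! q : E3, ∃ s t : I, s ≠ t ∧
      (grannyClasp d).arc i s = q ∧ (grannyClasp d).arc i t = q := by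
  have hβ : ∃ s t : I, s ≠ t ∧ beta d s = !₂[0, 0, -claspH / 2] ∧
      beta d t = !₂[0, 0, -claspH / 2] := by
    refine ⟨⟨1 / 4, by norm_num, by norm_num⟩, ⟨3 / 4, by norm_num, by norm_num⟩, ?_, ?_, ?_⟩
    · simp only [ne_eq]
      norm_num
    · rw [beta_eq, betaR_left d (by norm_num)]
      norm_num [halfX_two, halfZ_two]
    · rw [beta_eq, betaR_right d (by norm_num)]
      norm_num [halfX_two, halfZ_two]
  obtain ⟨s, t, hst, hs, ht⟩ := hβ
  fin_cases i
  · refine ⟨_, ⟨s, t, hst, hs, ht⟩, ?_⟩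
    rintro q ⟨s', t', hst', rfl, h⟩
    exact beta_eq_beta hd hst' h.symm
  · refine ⟨flip !₂[0, 0, -claspH / 2], ⟨s, t, hst, congrArg flip hs, congrArg flip ht⟩, ?_⟩
    rintro q ⟨s', t', hst', rfl, h⟩
    exact congrArg flip (beta_eq_beta hd hst' (flip.injective h.symm))

/-! ### Constraints -/

lemma mem_horizontalPlane {c : ℝ} {q : E3} : q ∈ horizontalPlane c ↔ q 2 = c := by
  rw [horizontalPlane, AffineSubspace.mem_mk']
  simp [sub_eq_zero]

lemma mem_horizontalPlane_direction {c : ℝ} {q : E3} :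
    q ∈ (horizontalPlane c).direction ↔ q 2 = 0 := by
  rw [horizontalPlane, AffineSubspace.direction_mk']
  simp

lemma grannyClasp_admits_iff {d : ℝ} {δ : Fin 2 → I → E3} :
    (grannyClasp d).Admits δ ↔ (∀ s t, δ 0 s ≠ δ 1 t) ∧
      (δ 0 0 2 = -ceil d ∧ δ 0 1 2 = -ceil d) ∧ (δ 1 0 2 = ceil d ∧ δ 1 1 2 = ceil d) ∧
      ∀ i s, |δ i s 2| ≤ ceil d := by
  simp only [GenLink.Admits, grannyClasp, Fin.forall_fin_two, Matrix.cons_val_zero,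
    Matrix.cons_val_one, mem_horizontalPlane, abs_le]
  constructor
  · rintro ⟨⟨⟨-, h⟩, -⟩, ⟨ha, hb⟩, ⟨h0, h1⟩, h2, h3⟩
    exact ⟨h (by simp), ha, hb, fun s => ⟨by linarith [h0 s], by linarith [h2 s]⟩,
      fun s => ⟨by linarith [h1 s], by linarith [h3 s]⟩⟩
  · rintro ⟨h, ha, hb, h0, h1⟩
    exact ⟨⟨⟨fun h => absurd rfl h, fun _ => h⟩, fun _ s t e => h t s e.symm,
      fun h => absurd rfl h⟩,
      ⟨ha, hb⟩, ⟨fun s => by linarith [(h0 s).1], fun s => by linarith [(h1 s).1]⟩,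
      fun s => by linarith [(h0 s).2], fun s => by linarith [(h1 s).2]⟩

lemma beta_zero_two (d : ℝ) : beta d 0 2 = -ceil d := by
  rw [beta_eq, Icc.coe_zero, betaR_left d (by norm_num), mul_zero, halfZ_zero]
  simp

lemma beta_one_two (d : ℝ) : beta d 1 2 = -ceil d := by
  rw [beta_eq, Icc.coe_one, betaR_right d (by norm_num), sub_self, mul_zero, halfZ_zero]
  simp

lemma grannyClasp_admits {d : ℝ} (hd : 0 < d) : (grannyClasp d).Admits (grannyClasp d).arc := by
  rw [grannyClasp_admits_iff]
  refine ⟨fun s t h => ?_, ⟨beta_zero_two d, beta_one_two d⟩, ⟨?_, ?_⟩, ?_⟩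
  · have h1 := one_le_dist_beta_gamma d s t
    have h2 : beta d s = gamma d t := h
    rw [h2, dist_self] at h1
    linarith
  · change -(beta d 0 2) = _
    rw [beta_zero_two, neg_neg]
  · change -(beta d 1 2) = _
    rw [beta_one_two, neg_neg]
  · intro i s
    fin_cases i
    · exact abs_beta_two_le hd s
    · change |-(beta d s 2)| ≤ _
      rw [abs_neg]
      exact abs_beta_two_le hd s

lemma grannyClasp_isGenLink {d : ℝ} (hd : 0 < d) : (grannyClasp d).IsGenLink := by
  refine ⟨?_, grannyClasp_admits hd, ?_⟩
  · intro i
    fin_cases i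
    · exact continuous_beta d
    · exact continuous_gamma d
  · let L : E3 →L[ℝ] ℝ := EuclideanSpace.proj (2 : Fin 3)
    have hp : ∀ q : E3, HasFDerivAt (fun q : E3 => q 2) L q := fun q => L.hasFDerivAt
    have hc : ContDiff ℝ 1 (fun q : E3 => q 2) := L.contDiff
    have hne : L ≠ 0 := fun h => by
      have h1 : L !₂[0, 0, 1] = 0 := by rw [h]; rfl
      simp [L] at h1
    intro j
    fin_cases j
    · refine ⟨hc.add contDiff_const, fun q _ => ?_⟩
      have : HasFDerivAt (fun q : E3 => q 2 + ceil d) _ q := (hp q).add_const _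
      exact this.fderiv.trans_ne hne
    · refine ⟨contDiff_const.sub hc, fun q _ => ?_⟩
      have : HasFDerivAt (fun q : E3 => ceil d - q 2) _ q := (hp q).const_sub _
      exact this.fderiv.trans_ne (neg_ne_zero.2 hne)

/-! ### The link homotopy to the standard picture

The homotopy has three stages, with parameters `a`, `b`, `c` that run from `0` to `1` one after the
other. First the components move in their planes, so that they can meet only on the axis. Then the
slab is twisted by a screw motion, and finally the two clasped pairs of strands are moved apart. -/

/-- Half the twisting angle, at height `ζ h`. -/
def screw (ζ : ℝ) : ℝ := 3 * Real.pi / 4 * (max (-1) (min 1 (3 * ζ)) + 1)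

/-- Distance by which the strands are moved apart at height `ζ h`. -/
def shift (ζ : ℝ) : ℝ := min 1 (2 - 3 * ζ)

/-- The relative height on the lower rope in the standard picture. -/
def level (s : ℝ) : ℝ := -1 + 10 / 3 * s

/-- Position in its plane of a strand during the first stage of the homotopy. -/
def planarX (a s : ℝ) : ℝ := (1 - a) * halfX (8 * s) + a * (2 * Real.cos (screw (level s)))

/-- Height of a strand during the first stage of the homotopy. -/
def planarZ (d a s : ℝ) : ℝ := (1 - a) * halfZ d (8 * s) + a * (ceil d * level s)

/-- A half of the lower component during the homotopy. -/
def lowerStrand (d a b c s : ℝ) : E3 :=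
  !₂[planarX a s * Real.cos (b * screw (level s)) + c * shift (level s),
    planarX a s * Real.sin (b * screw (level s)), planarZ d a s]

/-- A half of the upper component during the homotopy. -/
def upperStrand (d a b c s : ℝ) : E3 :=
  !₂[-(planarX a s * Real.sin (b * screw (-level s))) + c * shift (level s),
    planarX a s * Real.cos (b * screw (-level s)), -planarZ d a s]

/-- The half-turn about the `z`-axis. -/
def halfTurn (q : E3) : E3 := !₂[-q 0, -q 1, q 2]

/-- A strand followed by its image under the half-turn about the `z`-axis, traversed backwards. -/
def double (f : ℝ → E3) (s : ℝ) : E3 := if s ≤ 1 / 2 then f s else halfTurn (f (1 - s))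

lemma screw_neg (ζ : ℝ) : screw (-ζ) = 3 * Real.pi / 2 - screw ζ := by
  have h : max (-1) (min 1 (3 * -ζ)) = -max (-1) (min 1 (3 * ζ)) := by
    rw [mul_neg, max_def, max_def, min_def, min_def]
    split_ifs <;> linarith
  unfold screw
  rw [h]
  ring

lemma cos_three_pi_div_two_sub (x : ℝ) : Real.cos (3 * Real.pi / 2 - x) = -Real.sin x := by
  rw [show 3 * Real.pi / 2 - x = Real.pi / 2 - x + Real.pi by ring, Real.cos_add_pi,
    Real.cos_pi_div_two_sub]

lemma sin_three_pi_div_two_sub (x : ℝ) : Real.sin (3 * Real.pi / 2 - x) = -Real.cos x := by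
  rw [show 3 * Real.pi / 2 - x = Real.pi / 2 - x + Real.pi by ring, Real.sin_add_pi,
    Real.sin_pi_div_two_sub]

lemma cos_screw_neg (ζ : ℝ) : Real.cos (screw (-ζ)) = -Real.sin (screw ζ) := by
  rw [screw_neg, cos_three_pi_div_two_sub]

lemma sin_screw_neg (ζ : ℝ) : Real.sin (screw (-ζ)) = -Real.cos (screw ζ) := by
  rw [screw_neg, sin_three_pi_div_two_sub]

lemma screw_of_le {ζ : ℝ} (h : ζ ≤ -1 / 3) : screw ζ = 0 := by
  rw [screw, min_eq_right (by linarith), max_eq_left (by linarith)]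
  ring

lemma screw_of_ge {ζ : ℝ} (h : 1 / 3 ≤ ζ) : screw ζ = 3 * Real.pi / 2 := by
  rw [screw, min_eq_left (by linarith), max_eq_right (by norm_num)]
  ring

lemma screw_of_mem {ζ : ℝ} (h : ζ ∈ Icc (-1 / 3 : ℝ) (1 / 3)) : screw ζ = twist ζ / 2 := by
  rw [screw, min_eq_right (by linarith [h.2]), max_eq_right (by linarith [h.1]), twist]
  ring

lemma cos_three_pi_div_two : Real.cos (3 * Real.pi / 2) = 0 := by
  simpa using cos_three_pi_div_two_sub 0

/-- The screw angle reaches `π / 2` at `ζ = -1/9`, where the straightened strand crosses the axis.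
-/
lemma cos_screw_pos {ζ : ℝ} (h : ζ < -1 / 9) : 0 < Real.cos (screw ζ) := by
  rcases le_total ζ (-1 / 3) with h' | h'
  · rw [screw_of_le h', Real.cos_zero]
    exact one_pos
  · rw [screw_of_mem ⟨h', by linarith⟩, twist]
    have := Real.pi_pos
    exact Real.cos_pos_of_mem_Ioo ⟨by nlinarith, by nlinarith⟩

lemma cos_screw_neg_of_mem {ζ : ℝ} (h : ζ ∈ Ioo (-1 / 9 : ℝ) (1 / 3)) :
    Real.cos (screw ζ) < 0 := by
  rw [screw_of_mem ⟨by linarith [h.1], h.2.le⟩, twist]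
  have := Real.pi_pos
  exact Real.cos_neg_of_pi_div_two_lt_of_lt (by nlinarith [h.1]) (by nlinarith [h.2])

lemma shift_mem {ζ : ℝ} (h : ζ ≤ 2 / 3) : shift ζ ∈ Icc (0 : ℝ) 1 :=
  ⟨le_min zero_le_one (by linarith), min_le_left _ _⟩

lemma level_mem {s : ℝ} (hs : s ∈ Icc (0 : ℝ) (1 / 2)) : level s ∈ Icc (-1 : ℝ) (2 / 3) := by
  unfold level
  exact ⟨by linarith [hs.1], by linarith [hs.2]⟩

lemma eight_mul_mem {s : ℝ} (hs : s ∈ Icc (0 : ℝ) (1 / 2)) : 8 * s ∈ Icc (0 : ℝ) 4 :=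
  ⟨by linarith [hs.1], by linarith [hs.2]⟩

lemma planarX_half (a : ℝ) : planarX a (1 / 2) = 0 := by
  rw [planarX, level, screw_of_ge (by norm_num), cos_three_pi_div_two]
  norm_num [halfX_four]

lemma planarZ_zero (d a : ℝ) : planarZ d a 0 = -ceil d := by
  rw [planarZ, level, mul_zero, halfZ_zero]
  ring

lemma abs_planarZ_le {d a s : ℝ} (hd : 0 < d) (ha : a ∈ Icc (0 : ℝ) 1)
    (hs : s ∈ Icc (0 : ℝ) (1 / 2)) : |planarZ d a s| ≤ ceil d := by
  have h1 := halfZ_mem hd (eight_mul_mem hs)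
  have h2 := level_mem hs
  have h3 : 3 * claspH / 2 ≤ ceil d := by unfold ceil; linarith
  have hc := ceil_pos hd
  obtain ⟨a0, a1⟩ := ha
  have b0 : 0 ≤ 1 - a := by linarith
  rw [planarZ, abs_le]
  constructor
  · nlinarith [mul_le_mul_of_nonneg_left h1.1 b0, mul_le_mul_of_nonneg_left h2.1 hc.le,
      mul_nonneg a0 (mul_nonneg hc.le (by linarith [h2.1] : 0 ≤ level s + 1))]
  · nlinarith [mul_le_mul_of_nonneg_left (h1.2.trans h3) b0,
      mul_nonneg a0 (mul_nonneg hc.le (by linarith [h2.2] : 0 ≤ 1 - level s))]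

/-- During the first stage of the homotopy, the lower component meets the axis at two heights: one
slightly below zero, and the other one larger in absolute value and positive. -/
lemma planarZ_of_planarX_eq_zero {d a s : ℝ} (hd : 0 < d) (ha : a ∈ Icc (0 : ℝ) 1)
    (hs : s ∈ Icc (0 : ℝ) (1 / 2)) (h : planarX a s = 0) :
    (-((1 - a) * (claspH / 2) + a * (ceil d / 4)) ≤ planarZ d a s ∧ planarZ d a s < 0) ∨
      (1 - a) * (claspH / 2) + a * (ceil d / 4) < planarZ d a s := by
  have hc := ceil_pos hd
  obtain ⟨a0, a1⟩ := ha
  have b0 : 0 ≤ 1 - a := by linarith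
  have hpos : ∀ {x y : ℝ}, 0 < x → 0 < y → 0 < (1 - a) * x + a * y := by
    intro x y hx hy
    rcases a0.eq_or_lt with rfl | h
    · linarith
    · have := mul_pos h hy
      have := mul_nonneg b0 hx.le
      linarith
  have hm := strictMonoOn_halfZ hd
  -- The strand of clasp arcs crosses the axis at `s = 1/4` and the straightened one at `s = 4/15`,
  -- so their combinations cross in between. From `s = 2/5`, where `level s = 1/3`, the straightened
  -- strand runs along the axis; elsewhere both have the same strict sign.
  rcases lt_or_ge s (1 / 4) with h1 | h1
  · have := hpos (halfX_pos (s := 8 * s) ⟨by linarith [hs.1], by linarith⟩)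
      (mul_pos two_pos (cos_screw_pos (ζ := level s) (by unfold level; linarith)))
    exact absurd h this.ne'
  rcases le_or_gt s (4 / 15) with h2 | h2
  · left
    have hz0 : -claspH / 2 ≤ halfZ d (8 * s) := by
      rw [← halfZ_two d]
      exact hm.monotoneOn (by norm_num) (eight_mul_mem hs) (by linarith)
    have hz1 : halfZ d (8 * s) < 0 := by
      rw [halfZ_of_mem_two_three d ⟨by linarith, by linarith⟩]
      -- Here `8 * s - 2 ≤ 2/15` is the smaller of the two opposite clasp parameters, so its height
      -- is less than half of `claspH - gap`.
      have hu : 8 * s - 2 ∈ Icc (0 : ℝ) 1 := ⟨by linarith, by linarith⟩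
      have e := claspH_sub_eq_gap hu
      have := strictMonoOn_claspZ hu (one_sub_mem_Icc hu) (by linarith)
      have := gap_nonneg (8 * s - 2)
      linarith
    constructor
    · have e1 := mul_le_mul_of_nonneg_left hz0 b0
      have e2 : 0 ≤ a * (ceil d * (level s + 1 / 4)) :=
        mul_nonneg a0 (mul_nonneg hc.le (by unfold level; linarith))
      unfold planarZ
      linarith
    · have := hpos (neg_pos.2 hz1)
        (mul_pos hc (by unfold level; linarith : 0 < -level s))
      unfold planarZ
      linarith
  rcases lt_or_ge s (2 / 5) with h3 | h3
  · have := hpos (neg_pos.2 (halfX_neg (s := 8 * s) ⟨by linarith, by linarith⟩))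
      (neg_pos.2 (mul_neg_of_pos_of_neg two_pos (cos_screw_neg_of_mem (ζ := level s)
        ⟨by unfold level; linarith, by unfold level; linarith⟩)))
    unfold planarX at h
    linarith
  · right
    have hz : claspH / 2 < halfZ d (8 * s) := by
      rw [← halfZ_three d]
      exact hm (by norm_num) (eight_mul_mem hs) (by linarith)
    have := hpos (sub_pos.2 hz)
      (by unfold level; nlinarith : 0 < ceil d * level s - ceil d / 4)
    unfold planarZ
    linarith

/-- The strands, with any choice of half-turns, are disjoint during the homotopy. -/
lemma strands_disjoint {d a b c s t e : ℝ} (hd : 0 < d) (ha : a ∈ Icc (0 : ℝ) 1)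
    (hc : c ∈ Icc (0 : ℝ) 1) (hs : s ∈ Icc (0 : ℝ) (1 / 2)) (ht : t ∈ Icc (0 : ℝ) (1 / 2))
    (habc : b = 0 ∧ c = 0 ∨ a = 1 ∧ c = 0 ∨ a = 1 ∧ b = 1) (he : e = 1 ∨ e = -1)
    (h0 : lowerStrand d a b c s 0 = e * upperStrand d a b c t 0)
    (h1 : lowerStrand d a b c s 1 = e * upperStrand d a b c t 1)
    (h2 : lowerStrand d a b c s 2 = upperStrand d a b c t 2) : False := by
  simp only [lowerStrand, upperStrand, Matrix.cons_val] at h0 h1 h2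
  have hcd := ceil_pos hd
  have he0 : e ≠ 0 := by rcases he with rfl | rfl <;> norm_num
  have hlev : a = 1 → level s = -level t := by
    rintro rfl
    simp only [planarZ, sub_self, zero_mul, zero_add, one_mul] at h2
    have : ceil d * (level s + level t) = 0 := by linarith
    rcases mul_eq_zero.1 this with h | h <;> linarith
  have hsc := Real.sin_sq_add_cos_sq (screw (level s))
  have hX1 : planarX 1 s = 2 * Real.cos (screw (level s)) := by simp [planarX]
  have hX2 : a = 1 → planarX 1 t = -2 * Real.sin (screw (level s)) := fun h => by
    have : level t = -level s := by linarith [hlev h]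
    simp [planarX, this, cos_screw_neg]
  rcases habc with ⟨rfl, rfl⟩ | ⟨rfl, rfl⟩ | ⟨rfl, rfl⟩
  -- Stage one: a common point lies on the axis, and no two of the heights allowed there add up to
  -- zero.
  · simp only [zero_mul, Real.cos_zero, Real.sin_zero, mul_one, mul_zero, add_zero, neg_zero]
      at h0 h1
    have hx := h0
    have hy : planarX a t = 0 := by
      rcases mul_eq_zero.1 h1.symm with h | h
      · exact absurd h he0
      · exact h
    have k1 := mul_nonneg (sub_nonneg.2 ha.2) claspH_pos.le
    have k2 := mul_nonneg ha.1 hcd.le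
    rcases planarZ_of_planarX_eq_zero hd ha hs hx with ⟨h, h'⟩ | h <;>
      rcases planarZ_of_planarX_eq_zero hd ha ht hy with ⟨k, k'⟩ | k <;> linarith
  -- Stage two: at a common height the strands lie on perpendicular rotating lines, at signed
  -- distances `2 cos α` and `-2 sin α` from the axis, which never vanish together.
  · have hl := hlev rfl
    rw [← hl] at h0 h1
    simp only [zero_mul, add_zero] at h0 h1
    set p := Real.cos (b * screw (level s))
    set q := Real.sin (b * screw (level s))
    have hpq : q ^ 2 + p ^ 2 = 1 := Real.sin_sq_add_cos_sq _
    rw [hX1, hX2 rfl] at h0 h1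
    set C := Real.cos (screw (level s))
    set S := Real.sin (screw (level s))
    have hC : C = 0 := by linear_combination (-C) * hpq + p / 2 * h0 + q / 2 * h1
    have hS : e * S = 0 := by
      linear_combination (-(e * S)) * hpq - q / 2 * h0 + p / 2 * h1
    rcases mul_eq_zero.1 hS with h | h
    · exact he0 h
    · rw [hC, h] at hsc
      norm_num at hsc
  -- Stage three: strands on the same side (`e = 1`) differ by `2 (cos² α - sin² α)` up to shifts of
  -- at most 1, with `cos α * sin α = 0` forcing `±2`. For `e = -1` the first coordinates would give
  -- `2` plus nonnegative shifts equal to zero.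
  · have hl := hlev rfl
    rw [← hl] at h0 h1
    simp only [one_mul] at h0 h1
    rw [hX1, hX2 rfl] at h0 h1
    set C := Real.cos (screw (level s))
    set S := Real.sin (screw (level s))
    have s1 := shift_mem (level_mem hs).2
    have s2 := shift_mem (level_mem ht).2
    have k1 := mul_nonneg hc.1 s1.1
    have k2 := mul_nonneg hc.1 s2.1
    have k3 := mul_le_mul hc.2 s1.2 s1.1 zero_le_one
    have k4 := mul_le_mul hc.2 s2.2 s2.1 zero_le_one
    rcases he with rfl | rfl
    · have : C * S = 0 := by linarith
      rcases mul_eq_zero.1 this with h | h <;> rw [h] at h0 hsc <;> nlinarith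
    · nlinarith

/-- The half-turn is an involution preserving height, so only the relative sign `e` of the two
halves matters. -/
lemma double_disjoint {f g : ℝ → E3} {s t : ℝ} (hs : s ∈ Icc (0 : ℝ) 1) (ht : t ∈ Icc (0 : ℝ) 1)
    (h : ∀ s ∈ Icc (0 : ℝ) (1 / 2), ∀ t ∈ Icc (0 : ℝ) (1 / 2), ∀ e : ℝ, (e = 1 ∨ e = -1) →
      f s 0 = e * g t 0 → f s 1 = e * g t 1 → f s 2 = g t 2 → False) :
    double f s ≠ double g t := by
  intro heq
  have e0 : double f s 0 = double g t 0 := by rw [heq]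
  have e1 : double f s 1 = double g t 1 := by rw [heq]
  have e2 : double f s 2 = double g t 2 := by rw [heq]
  unfold double at e0 e1 e2
  split_ifs at e0 e1 e2 with h1 h2 h2 <;> simp only [halfTurn, Matrix.cons_val] at e0 e1 e2
  · exact h s ⟨hs.1, h1⟩ t ⟨ht.1, h2⟩ 1 (Or.inl rfl) (by linarith) (by linarith) e2
  · exact h s ⟨hs.1, h1⟩ (1 - t) ⟨by linarith [ht.2], by linarith⟩ (-1) (Or.inr rfl)
      (by linarith) (by linarith) e2
  · exact h (1 - s) ⟨by linarith [hs.2], by linarith⟩ t ⟨ht.1, h2⟩ (-1) (Or.inr rfl)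
      (by linarith) (by linarith) e2
  · exact h (1 - s) ⟨by linarith [hs.2], by linarith⟩ (1 - t) ⟨by linarith [ht.2], by linarith⟩ 1
      (Or.inl rfl) (by linarith) (by linarith) e2

lemma double_apply_two (f : ℝ → E3) (s : ℝ) :
    double f s 2 = f (min s (1 - s)) 2 := by
  unfold double
  split_ifs with h
  · rw [min_eq_left (by linarith)]
  · rw [min_eq_right (by linarith)]
    simp [halfTurn]

lemma min_one_sub_mem (s : I) : min (s : ℝ) (1 - s) ∈ Icc (0 : ℝ) (1 / 2) := by
  obtain ⟨h0, h1⟩ := s.2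
  refine ⟨le_min h0 (by linarith), ?_⟩
  rcases le_total (s : ℝ) (1 / 2) with h | h
  · exact (min_le_left _ _).trans h
  · exact (min_le_right _ _).trans (by linarith)

/-- Folding the parameter by `min s (1 - s)` requires continuity only on the first half, where the
strands are controlled. The halves match because they join on the axis. -/
lemma continuous_double {f : I → ℝ → E3}
    (hf : Continuous fun p : I × I => f p.1 (min (p.2 : ℝ) (1 - p.2)))
    (h0 : ∀ r, f r (1 / 2) 0 = 0) (h1 : ∀ r, f r (1 / 2) 1 = 0) :
    Continuous fun p : I × I => double (f p.1) p.2 := by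
  have hturn : Continuous halfTurn := by
    rw [continuous_iff_continuousAt]
    intro q
    have : Continuous fun q : E3 => (![-q 0, -q 1, q 2] : Fin 3 → ℝ) := by
      refine continuous_pi fun i => ?_
      fin_cases i <;> simp <;> fun_prop
    exact ((PiLp.continuous_toLp 2 _).comp this).continuousAt
  have hc : Continuous fun p : I × I => if (p.2 : ℝ) ≤ 1 / 2
      then f p.1 (min (p.2 : ℝ) (1 - p.2)) else halfTurn (f p.1 (min (p.2 : ℝ) (1 - p.2))) := by
    refine hf.if_le (hturn.comp hf) (by fun_prop) continuous_const fun p hp => ?_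
    have e : min (p.2 : ℝ) (1 - p.2) = 1 / 2 := by rw [hp]; norm_num
    rw [e]
    refine vec_ext ?_ ?_ rfl <;> simp only [halfTurn, Matrix.cons_val, h0, h1, neg_zero]
  refine hc.congr fun p => ?_
  unfold double
  split_ifs with h
  · rw [min_eq_left (by linarith)]
  · rw [min_eq_right (by linarith)]

lemma continuous_halfX_min : Continuous fun s : I => halfX (8 * min (s : ℝ) (1 - s)) :=
  continuousOn_halfX.comp_continuous (by fun_prop) fun s => eight_mul_mem (min_one_sub_mem s)

lemma continuous_halfZ_min (d : ℝ) : Continuous fun s : I => halfZ d (8 * min (s : ℝ) (1 - s)) :=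
  (continuousOn_halfZ d).comp_continuous (by fun_prop) fun s => eight_mul_mem (min_one_sub_mem s)

/-! ### Assembly of the three stages. -/

/-- The parameter of the first stage of the homotopy. -/
def stageOne (r : I) : ℝ := min 1 (3 * r)

/-- The parameter of the second stage of the homotopy. -/
def stageTwo (r : I) : ℝ := max 0 (min 1 (3 * r - 1))

/-- The parameter of the third stage of the homotopy. -/
def stageThree (r : I) : ℝ := max 0 (3 * r - 2)

lemma stageOne_mem (r : I) : stageOne r ∈ Icc (0 : ℝ) 1 :=
  ⟨le_min zero_le_one (by linarith [r.2.1]), min_le_left _ _⟩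

lemma stageThree_mem (r : I) : stageThree r ∈ Icc (0 : ℝ) 1 :=
  ⟨le_max_left _ _, max_le zero_le_one (by linarith [r.2.2])⟩

lemma stages (r : I) : stageTwo r = 0 ∧ stageThree r = 0 ∨ stageOne r = 1 ∧ stageThree r = 0 ∨
    stageOne r = 1 ∧ stageTwo r = 1 := by
  unfold stageOne stageTwo stageThree
  rcases le_total (r : ℝ) (1 / 3) with h | h
  · left
    exact ⟨max_eq_left ((min_le_right _ _).trans (by linarith)), max_eq_left (by linarith)⟩
  rcases le_total (r : ℝ) (2 / 3) with h' | h'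
  · right; left
    exact ⟨min_eq_left (by linarith), max_eq_left (by linarith)⟩
  · right; right
    refine ⟨min_eq_left (by linarith), ?_⟩
    rw [min_eq_left (by linarith)]
    exact max_eq_right zero_le_one

lemma continuous_vec {X : Type*} [TopologicalSpace X] {f g h : X → ℝ} (hf : Continuous f)
    (hg : Continuous g) (hh : Continuous h) : Continuous fun t => (!₂[f t, g t, h t] : E3) := by
  refine (PiLp.continuous_toLp 2 _).comp (continuous_pi fun i => ?_)
  fin_cases i
  · exact hf
  · exact hg
  · exact hh

/-- The link homotopy from the configuration of clasp arcs to the standard picture. -/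
def unclasp (d : ℝ) : Fin 2 → I × I → E3 :=
  ![fun p => double (lowerStrand d (stageOne p.1) (stageTwo p.1) (stageThree p.1)) p.2,
    fun p => double (upperStrand d (stageOne p.1) (stageTwo p.1) (stageThree p.1)) p.2]

lemma continuous_unclasp (d : ℝ) (i : Fin 2) : Continuous (unclasp d i) := by
  have c1 : Continuous stageOne := by unfold stageOne; fun_prop
  have c2 : Continuous stageTwo := by unfold stageTwo; fun_prop
  have c3 : Continuous stageThree := by unfold stageThree; fun_prop
  have cl : Continuous level := by unfold level; fun_prop
  have cs : Continuous screw := by unfold screw; fun_prop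
  have ch : Continuous shift := by unfold shift; fun_prop
  have hX := continuous_halfX_min
  have hZ := continuous_halfZ_min d
  have hX' : Continuous fun p : I × I => halfX (8 * min (p.2 : ℝ) (1 - p.2)) :=
    hX.comp continuous_snd
  have hZ' : Continuous fun p : I × I => halfZ d (8 * min (p.2 : ℝ) (1 - p.2)) :=
    hZ.comp continuous_snd
  have pX : Continuous fun p : I × I => planarX (stageOne p.1) (min (p.2 : ℝ) (1 - p.2)) := by
    unfold planarX
    fun_prop
  have pZ : Continuous fun p : I × I => planarZ d (stageOne p.1) (min (p.2 : ℝ) (1 - p.2)) := by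
    unfold planarZ
    fun_prop
  have hsh : shift (level (1 / 2)) = 0 := by norm_num [shift, level]
  fin_cases i
  · refine continuous_double (f := fun r => lowerStrand d (stageOne r) (stageTwo r) (stageThree r))
      (continuous_vec ?_ ?_ pZ) ?_ ?_
    · fun_prop
    · fun_prop
    · intro r
      simp only [lowerStrand, Matrix.cons_val, planarX_half, hsh]
      ring
    · intro r
      simp only [lowerStrand, Matrix.cons_val, planarX_half]
      ring
  · refine continuous_double (f := fun r => upperStrand d (stageOne r) (stageTwo r) (stageThree r))
      (continuous_vec ?_ ?_ pZ.neg) ?_ ?_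
    · fun_prop
    · fun_prop
    · intro r
      simp only [upperStrand, Matrix.cons_val, planarX_half, hsh]
      ring
    · intro r
      simp only [upperStrand, Matrix.cons_val, planarX_half]
      ring

lemma admits_unclasp {d : ℝ} (hd : 0 < d) (r : I) :
    (grannyClasp d).Admits fun i s => unclasp d i (r, s) := by
  rw [grannyClasp_admits_iff]
  have m0 : min ((0 : I) : ℝ) (1 - (0 : I)) = 0 := by norm_num
  have m1 : min ((1 : I) : ℝ) (1 - (1 : I)) = 0 := by norm_num
  refine ⟨fun s t => ?_, ⟨?_, ?_⟩, ⟨?_, ?_⟩, fun i s => ?_⟩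
  · refine double_disjoint s.2 t.2 fun s hs t ht e he h0 h1 h2 => ?_
    exact strands_disjoint hd (stageOne_mem r) (stageThree_mem r) hs ht (stages r) he h0 h1 h2
  · change double _ _ 2 = _
    rw [double_apply_two, m0]
    exact planarZ_zero d _
  · change double _ _ 2 = _
    rw [double_apply_two, m1]
    exact planarZ_zero d _
  · change double _ _ 2 = _
    rw [double_apply_two, m0]
    exact neg_eq_iff_eq_neg.2 (planarZ_zero d _)
  · change double _ _ 2 = _
    rw [double_apply_two, m1]
    exact neg_eq_iff_eq_neg.2 (planarZ_zero d _)
  · have h := abs_planarZ_le hd (stageOne_mem r) (min_one_sub_mem s)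
    fin_cases i
    · change |double _ _ 2| ≤ _
      rw [double_apply_two]
      exact h
    · change |double _ _ 2| ≤ _
      rw [double_apply_two]
      rw [← abs_neg] at h
      exact h

lemma lowerStrand_zero (d s : ℝ) :
    lowerStrand d 0 0 0 s = !₂[halfX (8 * s), 0, halfZ d (8 * s)] := by
  simp [lowerStrand, planarX, planarZ]

lemma upperStrand_zero (d s : ℝ) :
    upperStrand d 0 0 0 s = !₂[0, halfX (8 * s), -halfZ d (8 * s)] := by
  simp [upperStrand, planarX, planarZ]

lemma planarX_one (s : ℝ) : planarX 1 s = 2 * Real.cos (screw (level s)) := by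
  simp [planarX]

/-- The double-angle formulas turn a strand at distance `2 cos α`, rotated by `α`, into a circular
helix; the remaining unit shift centres it on `x₁ = 2`. -/
lemma lowerStrand_one (d : ℝ) {s : ℝ} :
    lowerStrand d 1 1 1 s = !₂[strandX (level s), strandY (level s), ceil d * level s] := by
  have hz : planarZ d 1 s = ceil d * level s := by simp [planarZ]
  simp only [lowerStrand, planarX_one, hz, one_mul]
  unfold strandX strandY
  generalize level s = ζ
  split_ifs with h1 h2
  · rw [screw_of_le h1, shift, min_eq_left (by linarith), Real.cos_zero, Real.sin_zero]
    norm_num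
  · rw [screw_of_mem ⟨by linarith, h2⟩, shift, min_eq_left (by linarith)]
    set x := twist ζ / 2
    rw [show twist ζ = 2 * x by ring, Real.cos_two_mul, Real.sin_two_mul]
    congr 1
    ext i
    fin_cases i
    · simp; ring
    · simp; ring
    · rfl
  · rw [screw_of_ge (by linarith), shift, min_eq_right (by linarith), cos_three_pi_div_two]
    norm_num

lemma upperStrand_one (d : ℝ) {s : ℝ} :
    upperStrand d 1 1 1 s =
      !₂[lowerStrand d 1 1 1 s 0, -lowerStrand d 1 1 1 s 1, -lowerStrand d 1 1 1 s 2] := by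
  refine vec_ext ?_ ?_ ?_ <;>
    simp [upperStrand, lowerStrand, cos_screw_neg, sin_screw_neg]

theorem grannyClasp_linkHomotopicTo {d : ℝ} (hd : 0 < d) :
    (grannyClasp d).LinkHomotopicTo (grannyPicture (ceil d)) := by
  refine ⟨unclasp d, continuous_unclasp d, ?_, ?_, admits_unclasp hd⟩
  · have e : stageOne 0 = 0 ∧ stageTwo 0 = 0 ∧ stageThree 0 = 0 := by
      norm_num [stageOne, stageTwo, stageThree]
    have h0 : ∀ s, unclasp d 0 (0, s) = beta d s := by
      intro s
      change double (lowerStrand d (stageOne 0) (stageTwo 0) (stageThree 0)) s = _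
      rw [e.1, e.2.1, e.2.2, double, beta]
      simp only [lowerStrand_zero]
      refine if_congr Iff.rfl rfl ?_
      refine vec_ext ?_ ?_ ?_ <;> simp [halfTurn]
    intro i s
    fin_cases i
    · exact h0 s
    · change double (upperStrand d (stageOne 0) (stageTwo 0) (stageThree 0)) s = gamma d s
      rw [e.1, e.2.1, e.2.2, double, gamma, beta]
      simp only [upperStrand_zero]
      split_ifs
      · rfl
      · refine vec_ext ?_ ?_ ?_ <;> simp [halfTurn]
  · have e : stageOne 1 = 1 ∧ stageTwo 1 = 1 ∧ stageThree 1 = 1 := by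
      norm_num [stageOne, stageTwo, stageThree]
    intro i s
    fin_cases i
    · change double (lowerStrand d (stageOne 1) (stageTwo 1) (stageThree 1)) s
        = lowerRope (ceil d) s
      rw [e.1, e.2.1, e.2.2, double, lowerRope]
      simp only [lowerStrand_one]
      refine if_congr Iff.rfl rfl ?_
      refine vec_ext ?_ ?_ ?_ <;> simp [halfTurn, level]
    · change double (upperStrand d (stageOne 1) (stageTwo 1) (stageThree 1)) s
        = upperRope (ceil d) s
      rw [e.1, e.2.1, e.2.2, double, upperRope, lowerRope]
      simp only [upperStrand_one, lowerStrand_one]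
      split_ifs
      · rfl
      · refine vec_ext ?_ ?_ ?_ <;> simp [halfTurn, level]

/-! ### The six clasp arcs of `β` -/

/-- The parameter on `β` of the point `u` on each of its six clasp arcs. -/
def arcParam (k : Fin 6) (u : ℝ) : ℝ :=
  ![(2 - u) / 8, (2 + u) / 8, (4 - u) / 8, (4 + u) / 8, (6 - u) / 8, (6 + u) / 8] k

/-- The side of the axis on which the arc lies. -/
def arcSide : Fin 6 → ℝ := ![1, -1, -1, 1, 1, -1]

/-- The height of the tip of the arc. -/
def arcBase : Fin 6 → ℝ := ![-claspH / 2, -claspH / 2, 3 * claspH / 2, 3 * claspH / 2,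
  -claspH / 2, -claspH / 2]

/-- The direction, up or down, in which the arc leaves its tip. -/
def arcDir : Fin 6 → ℝ := ![-1, 1, -1, -1, 1, -1]

lemma arcSide_sq (k : Fin 6) : arcSide k ^ 2 = 1 := by
  fin_cases k <;> norm_num [arcSide]

lemma arcDir_sq (k : Fin 6) : arcDir k ^ 2 = 1 := by
  fin_cases k <;> norm_num [arcDir]

/-- The arc from its tip, as a curve. -/
def arcCurve (k : Fin 6) (u : ℝ) : E3 :=
  !₂[arcSide k * claspX u, 0, arcBase k + arcDir k * claspZ u]

lemma betaR_arcParam (d : ℝ) (k : Fin 6) {u : ℝ} (hu : u ∈ Icc (0 : ℝ) 1) :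
    betaR d (arcParam k u) = arcCurve k u := by
  obtain ⟨h0, h1⟩ := hu
  have e1 : (8 : ℝ) * ((2 - u) / 8) = 2 - u := by ring
  have e2 : (8 : ℝ) * ((2 + u) / 8) = 2 + u := by ring
  have e3 : (8 : ℝ) * ((4 - u) / 8) = 4 - u := by ring
  have e4 : (8 : ℝ) * (1 - (4 + u) / 8) = 4 - u := by ring
  have e5 : (8 : ℝ) * (1 - (6 - u) / 8) = 2 + u := by ring
  have e6 : (8 : ℝ) * (1 - (6 + u) / 8) = 2 - u := by ring
  fin_cases k
  · change betaR d ((2 - u) / 8) = _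
    rw [betaR_left d (by linarith), e1, halfX_of_mem_one_two ⟨by linarith, by linarith⟩,
      halfZ_of_mem_one_two d ⟨by linarith, by linarith⟩]
    refine vec_ext ?_ rfl ?_ <;> simp [arcCurve, arcSide, arcBase, arcDir, sub_eq_add_neg]
  · change betaR d ((2 + u) / 8) = _
    rw [betaR_left d (by linarith), e2, halfX_of_mem_two_three ⟨by linarith, by linarith⟩,
      halfZ_of_mem_two_three d ⟨by linarith, by linarith⟩]
    refine vec_ext ?_ rfl ?_ <;> simp [arcCurve, arcSide, arcBase, arcDir]
  · change betaR d ((4 - u) / 8) = _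
    rw [betaR_left d (by linarith), e3, halfX_of_mem_three_four ⟨by linarith, by linarith⟩,
      halfZ_of_mem_three_four d ⟨by linarith, by linarith⟩]
    refine vec_ext ?_ rfl ?_ <;> simp [arcCurve, arcSide, arcBase, arcDir, sub_eq_add_neg]
  · change betaR d ((4 + u) / 8) = _
    rw [betaR_right d (by linarith), e4, halfX_of_mem_three_four ⟨by linarith, by linarith⟩,
      halfZ_of_mem_three_four d ⟨by linarith, by linarith⟩]
    refine vec_ext ?_ rfl ?_ <;> simp [arcCurve, arcSide, arcBase, arcDir, sub_eq_add_neg]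
  · change betaR d ((6 - u) / 8) = _
    rw [betaR_right d (by linarith), e5, halfX_of_mem_two_three ⟨by linarith, by linarith⟩,
      halfZ_of_mem_two_three d ⟨by linarith, by linarith⟩]
    refine vec_ext ?_ rfl ?_ <;> simp [arcCurve, arcSide, arcBase, arcDir]
  · change betaR d ((6 + u) / 8) = _
    rw [betaR_right d (by linarith), e6, halfX_of_mem_one_two ⟨by linarith, by linarith⟩,
      halfZ_of_mem_one_two d ⟨by linarith, by linarith⟩]
    refine vec_ext ?_ rfl ?_ <;> simp [arcCurve, arcSide, arcBase, arcDir, sub_eq_add_neg]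

lemma arcParam_mem (k : Fin 6) {u : ℝ} (hu : u ∈ Icc (0 : ℝ) 1) :
    arcParam k u ∈ Icc (0 : ℝ) 1 := by
  obtain ⟨h0, h1⟩ := hu
  fin_cases k <;> simp [arcParam] <;> constructor <;> linarith

lemma continuous_arcParam (k : Fin 6) : Continuous (arcParam k) := by
  unfold arcParam
  fin_cases k <;> simp <;> fun_prop

lemma exists_hasDerivAt_arcParam (k : Fin 6) : ∃ c : ℝ, ∀ u, HasDerivAt (arcParam k) c u := by
  have hp : ∀ p u : ℝ, HasDerivAt (fun u : ℝ => (p + u) / 8) (1 / 8) u := fun p u =>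
    ((hasDerivAt_id u).const_add p).div_const 8
  have hm : ∀ p u : ℝ, HasDerivAt (fun u : ℝ => (p - u) / 8) (-1 / 8) u := fun p u =>
    ((hasDerivAt_id u).const_sub p).div_const 8
  fin_cases k
  · exact ⟨_, hm 2⟩
  · exact ⟨_, hp 2⟩
  · exact ⟨_, hm 4⟩
  · exact ⟨_, hp 4⟩
  · exact ⟨_, hm 6⟩
  · exact ⟨_, hp 6⟩

/-- The density of the curvature force on a clasp arc. -/
def arcForce (k : Fin 6) (u : ℝ) : E3 := !₂[arcSide k * claspSlope u, 0, -arcDir k]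

lemma intervalIntegrable_vec {f g h : ℝ → ℝ} {a b : ℝ} (hf : IntervalIntegrable f volume a b)
    (hg : IntervalIntegrable g volume a b) (hh : IntervalIntegrable h volume a b) :
    IntervalIntegrable (fun t => (!₂[f t, g t, h t] : E3)) volume a b := by
  have e : (fun t => (!₂[f t, g t, h t] : E3)) = fun t => f t • (!₂[1, 0, 0] : E3)
      + g t • (!₂[0, 1, 0] : E3) + h t • (!₂[0, 0, 1] : E3) := by
    funext t
    refine vec_ext ?_ ?_ ?_ <;> simp
  rw [e]
  exact ((hf.smul_continuousOn continuousOn_const).add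
    (hg.smul_continuousOn continuousOn_const)).add
    (hh.smul_continuousOn continuousOn_const)

lemma intervalIntegrable_arcForce (k : Fin 6) : IntervalIntegrable (arcForce k) volume 0 1 :=
  intervalIntegrable_vec (intervalIntegrable_slope.const_mul _) (by simp) (by simp)

/-- The speed of the clasp arc. -/
def claspSpeed (u : ℝ) : ℝ := deriv claspX u / Real.sqrt (1 - u ^ 2)

lemma intervalIntegrable_claspSpeed : IntervalIntegrable claspSpeed volume 0 1 := by
  -- The speed is the inner product of the velocity with the unit tangent `(√(1 - u²), u)`, a sum of
  -- bounded multiples of integrable functions.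
  have h : IntervalIntegrable (fun u => Real.sqrt (1 - u ^ 2) * deriv claspX u
      + u * (claspSlope u * deriv claspX u)) volume 0 1 :=
    (intervalIntegrable_deriv_claspX.continuousOn_mul (by fun_prop)).add
      (intervalIntegrable_deriv_claspZ.continuousOn_mul (by fun_prop))
  refine h.congr_uIoo ?_
  rw [uIoo_of_le zero_le_one]
  intro u hu
  have h1 := sqrt_one_sub_sq_pos hu
  have h2 : Real.sqrt (1 - u ^ 2) ^ 2 = 1 - u ^ 2 := Real.sq_sqrt (by nlinarith [hu.1, hu.2])
  simp only [claspSpeed, claspSlope]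
  field_simp
  rw [h2]
  ring

/-- First variation of the length of a clasp arc. -/
lemma hasDerivAt_length_arcCurve (k : Fin 6) {f f' : ℝ → E3} (hf : ∀ s, HasDerivAt f (f' s) s)
    (hf' : Continuous f') :
    (∀ t : ℝ, eVariationOn (fun u => arcCurve k u + t • f (arcParam k u)) (Icc 0 1) ≠ ⊤) ∧
    HasDerivAt (fun t : ℝ =>
        (eVariationOn (fun u => arcCurve k u + t • f (arcParam k u)) (Icc 0 1)).toReal)
      (arcDir k * f (arcParam k 1) 2 - arcSide k * f (arcParam k 0) 0
        + ∫ u in (0 : ℝ)..1, inner ℝ (arcForce k u) (f (arcParam k u))) 0 := by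
  obtain ⟨c, hc⟩ := exists_hasDerivAt_arcParam k
  have h := hasDerivAt_length (f := arcCurve k)
    (T := fun u => !₂[arcSide k * Real.sqrt (1 - u ^ 2), 0, arcDir k * u])
    (T' := fun u => -arcForce k u) (ζ := fun u => f (arcParam k u))
    (ζ' := fun u => c • f' (arcParam k u)) (ρ := claspSpeed)
    (continuousOn_vec (continuousOn_const.mul continuousOn_claspX) continuousOn_const
      (continuousOn_const.add (continuousOn_const.mul continuousOn_claspZ))) ?_ ?_ ?_
    intervalIntegrable_claspSpeed
    (continuousOn_vec (by fun_prop) continuousOn_const (by fun_prop)) ?_ ?_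
    (intervalIntegrable_arcForce k).neg (fun u => (hf _).scomp u (hc u))
    ((hf'.comp (continuous_arcParam k)).const_smul c)
  · refine ⟨h.1, h.2.congr_deriv ?_⟩
    simp only [inner_neg_left, intervalIntegral.integral_neg, sub_neg_eq_add]
    congr 1
    simp [inner_vec]
  · intro u hu
    have h1 := sqrt_one_sub_sq_pos hu
    refine (hasDerivAt_vec ((hasDerivAt_claspX' hu).const_mul _) (hasDerivAt_const u 0)
      (((hasDerivAt_claspZ hu).const_mul _).const_add _)).congr_deriv ?_
    refine vec_ext ?_ ?_ ?_ <;> simp [claspSpeed, claspSlope] <;> field_simp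
  · exact fun u hu => div_pos (deriv_claspX_pos hu) (sqrt_one_sub_sq_pos hu)
  · exact (continuousOn_deriv_claspX.mono Ioo_subset_Ioc_self).div (by fun_prop)
      fun u hu => (sqrt_one_sub_sq_pos hu).ne'
  · intro u hu
    have h2 : Real.sqrt (1 - u ^ 2) ^ 2 = 1 - u ^ 2 := Real.sq_sqrt (by nlinarith [hu.1, hu.2])
    rw [← sq_eq_sq₀ (norm_nonneg _) zero_le_one, norm_vec_sq]
    simp only [Matrix.cons_val, mul_pow, arcSide_sq, arcDir_sq, h2]
    ring
  · intro u hu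
    refine (hasDerivAt_vec ((hasDerivAt_sqrt_one_sub_sq hu).const_mul _) (hasDerivAt_const u 0)
      ((hasDerivAt_id u).const_mul _)).congr_deriv ?_
    refine vec_ext ?_ ?_ ?_ <;> simp [arcForce]

/-- First variation of the length of a straight segment. -/
lemma hasDerivAt_length_segment {p T : E3} {v : ℝ} (hv : 0 < v) (hT : ‖T‖ = 1) {f f' : ℝ → E3}
    {q : ℝ} (hf : ∀ s, HasDerivAt f (f' s) s) (hf' : Continuous f') :
    (∀ t : ℝ, eVariationOn (fun u : ℝ => p + (v * u) • T + t • f ((q + u) / 8)) (Icc 0 1) ≠ ⊤) ∧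
    HasDerivAt (fun t : ℝ =>
        (eVariationOn (fun u : ℝ => p + (v * u) • T + t • f ((q + u) / 8)) (Icc 0 1)).toReal)
      (inner ℝ T (f ((q + 1) / 8)) - inner ℝ T (f (q / 8))) 0 := by
  have h := hasDerivAt_length (f := fun u : ℝ => p + (v * u) • T)
    (T := fun _ => T) (T' := fun _ => 0) (ζ := fun u => f ((q + u) / 8))
    (ζ' := fun u => (1 / 8 : ℝ) • f' ((q + u) / 8)) (ρ := fun _ => v)
    (by fun_prop) ?_ (fun _ _ => hv) continuousOn_const (by simp) continuousOn_const
    (fun _ _ => hT) (fun _ _ => hasDerivAt_const _ _) (by simp)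
    (fun u => (hf _).scomp u (((hasDerivAt_id u).const_add q).div_const 8)) (by fun_prop)
  · refine ⟨h.1, h.2.congr_deriv ?_⟩
    simp
  · intro u _
    simpa using ((((hasDerivAt_id u).const_mul v).smul_const T).const_add p)

/-! ### First variation of the length of `β` -/

lemma eVariationOn_comp_add_div (g : ℝ → E3) (p : ℝ) :
    eVariationOn (fun u => g ((p + u) / 8)) (Icc 0 1) =
      eVariationOn g (Icc (p / 8) ((p + 1) / 8)) := by
  have h := eVariationOn.comp_eq_of_monotoneOn g (t := Icc 0 1) (fun u : ℝ => (p + u) / 8)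
    (fun x _ y _ hxy => by dsimp only; linarith)
  refine h.trans (congrArg _ ?_)
  ext s
  constructor
  · rintro ⟨u, ⟨h0, h1⟩, rfl⟩
    constructor <;> linarith
  · rintro ⟨h0, h1⟩
    exact ⟨8 * s - p, ⟨by linarith, by linarith⟩, by ring⟩

lemma eVariationOn_comp_sub_div (g : ℝ → E3) (p : ℝ) :
    eVariationOn (fun u => g ((p - u) / 8)) (Icc 0 1) =
      eVariationOn g (Icc ((p - 1) / 8) (p / 8)) := by
  have h := eVariationOn.comp_eq_of_antitoneOn g (t := Icc 0 1) (fun u : ℝ => (p - u) / 8)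
    (fun x _ y _ hxy => by dsimp only; linarith)
  refine h.trans (congrArg _ ?_)
  ext s
  constructor
  · rintro ⟨u, ⟨h0, h1⟩, rfl⟩
    constructor <;> linarith
  · rintro ⟨h0, h1⟩
    exact ⟨p - 8 * s, ⟨by linarith, by linarith⟩, by ring⟩

lemma eVariationOn_comp_arcParam (g : ℝ → E3) (k : Fin 6) :
    eVariationOn (fun u => g (arcParam k u)) (Icc 0 1) =
      eVariationOn g (Icc (((k : ℕ) + 1) / 8) (((k : ℕ) + 2) / 8)) := by
  fin_cases k
  · refine (eVariationOn_comp_sub_div g 2).trans ?_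
    norm_num
  · refine (eVariationOn_comp_add_div g 2).trans ?_
    norm_num
  · refine (eVariationOn_comp_sub_div g 4).trans ?_
    norm_num
  · refine (eVariationOn_comp_add_div g 4).trans ?_
    norm_num
  · refine (eVariationOn_comp_sub_div g 6).trans ?_
    norm_num
  · refine (eVariationOn_comp_add_div g 6).trans ?_
    norm_num

lemma eVariationOn_eq_sum_arcs (g : ℝ → E3) :
    eVariationOn g (Icc 0 1) = eVariationOn (fun u => g ((0 + u) / 8)) (Icc 0 1)
      + ∑ k, eVariationOn (fun u => g (arcParam k u)) (Icc 0 1)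
      + eVariationOn (fun u => g ((7 + u) / 8)) (Icc 0 1) := by
  have split : ∀ {a b c : ℝ}, a ≤ b → b ≤ c →
      eVariationOn g (Icc a c) = eVariationOn g (Icc a b) + eVariationOn g (Icc b c) := by
    intro a b c hab hbc
    have h := eVariationOn.Icc_add_Icc g (s := univ) hab hbc (mem_univ b)
    simpa only [univ_inter] using h.symm
  rw [eVariationOn_comp_add_div, eVariationOn_comp_add_div, Fin.sum_univ_six]
  simp only [eVariationOn_comp_arcParam]
  rw [split (b := 1 / 8) (by norm_num) (by norm_num), split (a := 1 / 8) (b := 2 / 8) (by norm_num)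
    (by norm_num), split (a := 2 / 8) (b := 3 / 8) (by norm_num) (by norm_num),
    split (a := 3 / 8) (b := 4 / 8) (by norm_num) (by norm_num),
    split (a := 4 / 8) (b := 5 / 8) (by norm_num) (by norm_num),
    split (a := 5 / 8) (b := 6 / 8) (by norm_num) (by norm_num),
    split (a := 6 / 8) (b := 7 / 8) (by norm_num) (by norm_num)]
  norm_num [add_assoc]

/-- First variation of the length of `β` along `C¹` fields: minus the integral against the
curvature, plus boundary terms. -/
lemma hasDerivAt_length_beta {d : ℝ} (hd : 0 < d) {f f' : ℝ → E3}
    (hf : ∀ s, HasDerivAt f (f' s) s) (hf' : Continuous f') :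
    (∀ t : ℝ, eVariationOn (fun s => betaR d s + t • f s) (Icc 0 1) ≠ ⊤) ∧
    HasDerivAt (fun t : ℝ => (eVariationOn (fun s => betaR d s + t • f s) (Icc 0 1)).toReal)
      (-(f 0 2) - f 1 2
        + ∑ k, ∫ u in (0 : ℝ)..1, inner ℝ (arcForce k u) (f (arcParam k u))) 0 := by
  have hn : ‖(!₂[0, 0, 1] : E3)‖ = 1 := by
    rw [← sq_eq_sq₀ (norm_nonneg _) zero_le_one, norm_vec_sq]
    simp
  have hn' : ‖(!₂[0, 0, -1] : E3)‖ = 1 := by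
    rw [← sq_eq_sq₀ (norm_nonneg _) zero_le_one, norm_vec_sq]
    simp
  have s1 := hasDerivAt_length_segment (p := !₂[1, 0, -ceil d]) (q := 0) hd hn hf hf'
  have s2 := hasDerivAt_length_segment (p := !₂[-1, 0, -ceil d + d]) (q := 7) hd hn' hf hf'
  have ar := fun k => hasDerivAt_length_arcCurve k hf hf'
  have e1 : ∀ t : ℝ, eVariationOn (fun u => betaR d ((0 + u) / 8) + t • f ((0 + u) / 8)) (Icc 0 1)
      = eVariationOn (fun u : ℝ => !₂[1, 0, -ceil d] + (d * u) • !₂[0, 0, 1]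
        + t • f ((0 + u) / 8)) (Icc 0 1) := fun t => eVariationOn.congr fun u hu => by
    rw [betaR_left d (by linarith [hu.2]), halfX_of_mem_zero_one ⟨by linarith [hu.1], by
      linarith [hu.2]⟩, halfZ_of_mem_zero_one d ⟨by linarith [hu.1], by linarith [hu.2]⟩]
    congr 1
    refine vec_ext ?_ ?_ ?_ <;> simp
    ring
  have e2 : ∀ t : ℝ, eVariationOn (fun u => betaR d ((7 + u) / 8) + t • f ((7 + u) / 8)) (Icc 0 1)
      = eVariationOn (fun u : ℝ => !₂[-1, 0, -ceil d + d] + (d * u) • !₂[0, 0, -1]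
        + t • f ((7 + u) / 8)) (Icc 0 1) := fun t => eVariationOn.congr fun u hu => by
    rw [betaR_right d (by linarith [hu.1]), halfX_of_mem_zero_one ⟨by linarith [hu.2], by
      linarith [hu.1]⟩, halfZ_of_mem_zero_one d ⟨by linarith [hu.2], by linarith [hu.1]⟩]
    congr 1
    refine vec_ext ?_ ?_ ?_ <;> simp
    ring
  have e3 : ∀ (t : ℝ) (k : Fin 6),
      eVariationOn (fun u => betaR d (arcParam k u) + t • f (arcParam k u)) (Icc 0 1)
      = eVariationOn (fun u => arcCurve k u + t • f (arcParam k u)) (Icc 0 1) :=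
    fun t k => eVariationOn.congr fun u hu => by
      rw [betaR_arcParam d k hu]
  have hsum : ∀ t : ℝ, eVariationOn (fun s => betaR d s + t • f s) (Icc 0 1) =
      eVariationOn (fun u : ℝ => !₂[1, 0, -ceil d] + (d * u) • !₂[0, 0, 1]
        + t • f ((0 + u) / 8)) (Icc 0 1)
      + ∑ k, eVariationOn (fun u => arcCurve k u + t • f (arcParam k u)) (Icc 0 1)
      + eVariationOn (fun u : ℝ => !₂[-1, 0, -ceil d + d] + (d * u) • !₂[0, 0, -1]
        + t • f ((7 + u) / 8)) (Icc 0 1) := by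
    intro t
    rw [eVariationOn_eq_sum_arcs, e1, e2]
    simp only [e3]
  have hfin : ∀ t : ℝ,
      ∑ k, eVariationOn (fun u => arcCurve k u + t • f (arcParam k u)) (Icc 0 1) ≠ ⊤ :=
    fun t => ENNReal.sum_ne_top.2 fun k _ => (ar k).1 t
  refine ⟨fun t => ?_, ?_⟩
  · rw [hsum]
    exact ENNReal.add_ne_top.2 ⟨ENNReal.add_ne_top.2 ⟨s1.1 t, hfin t⟩, s2.1 t⟩
  · have hreal : (fun t : ℝ => (eVariationOn (fun s => betaR d s + t • f s) (Icc 0 1)).toReal) =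
        fun t : ℝ => (eVariationOn (fun u : ℝ => !₂[1, 0, -ceil d] + (d * u) • !₂[0, 0, 1]
          + t • f ((0 + u) / 8)) (Icc 0 1)).toReal
        + ∑ k, (eVariationOn (fun u => arcCurve k u + t • f (arcParam k u)) (Icc 0 1)).toReal
        + (eVariationOn (fun u : ℝ => !₂[-1, 0, -ceil d + d] + (d * u) • !₂[0, 0, -1]
          + t • f ((7 + u) / 8)) (Icc 0 1)).toReal := by
      funext t
      rw [hsum, ENNReal.toReal_add (ENNReal.add_ne_top.2 ⟨s1.1 t, hfin t⟩) (s2.1 t),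
        ENNReal.toReal_add (s1.1 t) (hfin t), ENNReal.toReal_sum fun k _ => (ar k).1 t]
    rw [hreal]
    refine ((s1.2.add (HasDerivAt.fun_sum fun k _ => (ar k).2)).add s2.2).congr_deriv ?_
    rw [Finset.sum_add_distrib]
    -- The tangent is continuous across the junctions of arcs, so the boundary terms there
    -- telescope; the two left over cancel against the straight segments.
    have hb : ∑ k, (arcDir k * f (arcParam k 1) 2 - arcSide k * f (arcParam k 0) 0) =
        f (7 / 8) 2 * (-1) - f (1 / 8) 2 := by
      rw [Fin.sum_univ_six]
      simp only [arcDir, arcSide, arcParam, Matrix.cons_val]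
      norm_num
      ring
    rw [hb]
    simp only [inner_vec, Matrix.cons_val]
    norm_num
    ring

/-! ### The first variation as a continuous functional. -/

/-- The vector field `ζ` at a real parameter. -/
def fieldAt (ζ : C(I, E3)) (s : ℝ) : E3 := ζ (projIcc 0 1 zero_le_one s)

lemma continuous_fieldAt (ζ : C(I, E3)) : Continuous (fieldAt ζ) :=
  ζ.continuous.comp continuous_projIcc

lemma fieldAt_of_mem (ζ : C(I, E3)) {s : ℝ} (hs : s ∈ Icc (0 : ℝ) 1) : fieldAt ζ s = ζ ⟨s, hs⟩ := by
  rw [fieldAt, projIcc_of_mem _ hs]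

lemma intervalIntegrable_arcForce_inner (ζ : C(I, E3)) (k : Fin 6) :
    IntervalIntegrable (fun u => inner ℝ (arcForce k u) (fieldAt ζ (arcParam k u))) volume 0 1 :=
  intervalIntegrable_inner (intervalIntegrable_arcForce k)
    ((continuous_fieldAt ζ).comp (continuous_arcParam k))

/-- The work of the curvature force of a clasp arc. -/
def arcWork (k : Fin 6) : C(I, E3) →L[ℝ] ℝ :=
  LinearMap.mkContinuous
    { toFun := fun ζ => ∫ u in (0 : ℝ)..1, inner ℝ (arcForce k u) (fieldAt ζ (arcParam k u))
      map_add' := fun ζ η => by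
        rw [← intervalIntegral.integral_add (intervalIntegrable_arcForce_inner ζ k)
          (intervalIntegrable_arcForce_inner η k)]
        exact intervalIntegral.integral_congr fun u _ => inner_add_right _ _ _
      map_smul' := fun c ζ => by
        rw [RingHom.id_apply, smul_eq_mul, ← intervalIntegral.integral_const_mul]
        exact intervalIntegral.integral_congr fun u _ => real_inner_smul_right _ _ _ }
    (∫ u in (0 : ℝ)..1, ‖arcForce k u‖) fun ζ => by
      refine (intervalIntegral.norm_integral_le_integral_norm zero_le_one).trans ?_
      rw [← intervalIntegral.integral_mul_const]
      refine intervalIntegral.integral_mono_on zero_le_one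
        (intervalIntegrable_arcForce_inner ζ k).norm
        ((intervalIntegrable_arcForce k).norm.mul_const _) fun u _ => ?_
      exact (norm_inner_le_norm _ _).trans
        (mul_le_mul_of_nonneg_left (ζ.norm_coe_le_norm _) (norm_nonneg _))

lemma arcWork_apply (k : Fin 6) (ζ : C(I, E3)) : arcWork k ζ =
    ∫ u in (0 : ℝ)..1, inner ℝ (arcForce k u) (fieldAt ζ (arcParam k u)) := rfl

/-- The first variation of the length of `β`. -/
def betaVariation : C(I, E3) →L[ℝ] ℝ :=
  -((EuclideanSpace.proj (2 : Fin 3) : E3 →L[ℝ] ℝ) ∘L ContinuousMap.evalCLM ℝ (0 : I))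
    - (EuclideanSpace.proj (2 : Fin 3) : E3 →L[ℝ] ℝ) ∘L ContinuousMap.evalCLM ℝ (1 : I)
    + ∑ k, arcWork k

lemma betaVariation_apply (ζ : C(I, E3)) :
    betaVariation ζ = -(ζ 0 2) - ζ 1 2 + ∑ k, arcWork k ζ := by
  simp [betaVariation]

/-- The rotation `flip` on vector fields. -/
def flipField : C(I, E3) →L[ℝ] C(I, E3) :=
  flip.toContinuousLinearMap.compLeftContinuous ℝ I

lemma flipField_apply (ζ : C(I, E3)) (s : I) : flipField ζ s = flip (ζ s) := rfl

/-- The first variation of the length of the granny clasp. -/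
def grannyVariation : (Fin 2 → C(I, E3)) →L[ℝ] ℝ :=
  betaVariation ∘L ContinuousLinearMap.proj 0
    + (betaVariation ∘L flipField) ∘L ContinuousLinearMap.proj 1

lemma grannyVariation_apply (ξ : Fin 2 → C(I, E3)) :
    grannyVariation ξ = betaVariation (ξ 0) + betaVariation (flipField (ξ 1)) := rfl

lemma flip_flip (q : E3) : flip (flip q) = q := by
  refine vec_ext ?_ ?_ ?_ <;> simp [flip_apply]

lemma eVariationOn_flip_comp (g : I → E3) :
    eVariationOn (fun s => flip (g s)) univ = eVariationOn g univ := by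
  simp only [eVariationOn, flip.isometry.edist_eq]

lemma eVariationOn_unitInterval (g : ℝ → E3) :
    eVariationOn (fun s : I => g s) univ = eVariationOn g (Icc 0 1) := by
  refine (eVariationOn.comp_eq_of_monotoneOn g (t := univ) (fun s : I => (s : ℝ))
    (fun x _ y _ h => h)).trans ?_
  rw [image_univ, Subtype.range_coe]

lemma hasDerivAt_length_beta_move {d : ℝ} (hd : 0 < d) {ζ : C(I, E3)} {f : ℝ → E3}
    (hf : ContDiff ℝ 1 f) (hζ : ∀ s : I, ζ s = f s) :
    (∀ t : ℝ, eVariationOn (fun s => beta d s + t • ζ s) univ ≠ ⊤) ∧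
    HasDerivAt (fun t : ℝ => (eVariationOn (fun s => beta d s + t • ζ s) univ).toReal)
      (betaVariation ζ) 0 := by
  have h := hasDerivAt_length_beta hd (f := f) (f' := deriv f)
    (fun s => (hf.differentiable (by norm_num) s).hasDerivAt) (hf.continuous_deriv le_rfl)
  have e : ∀ t : ℝ, eVariationOn (fun s => beta d s + t • ζ s) univ =
      eVariationOn (fun s => betaR d s + t • f s) (Icc 0 1) := by
    intro t
    rw [← eVariationOn_unitInterval]
    simp only [hζ, beta_eq]
  simp only [e]
  refine ⟨h.1, h.2.congr_deriv ?_⟩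
  rw [betaVariation_apply, hζ 0, hζ 1]
  congr 1
  refine Finset.sum_congr rfl fun k _ => ?_
  rw [arcWork_apply]
  refine intervalIntegral.integral_congr fun u hu => ?_
  rw [uIcc_of_le zero_le_one] at hu
  rw [fieldAt_of_mem ζ (arcParam_mem k hu), hζ]

lemma isFirstVariationOfLen_grannyVariation {d : ℝ} (hd : 0 < d) :
    IsFirstVariationOfLen (grannyClasp d).arc grannyVariation := by
  -- Since `flip` is an isometric involution, moving `γ` along `ζ` has the same length as moving `β`
  -- along the flipped field.
  have hgam : ∀ (ζ : C(I, E3)) (t : ℝ), eVariationOn (fun s => gamma d s + t • ζ s) univ =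
      eVariationOn (fun s => beta d s + t • flipField ζ s) univ := by
    intro ζ t
    rw [← eVariationOn_flip_comp]
    congr 1
    funext s
    rw [gamma_eq, map_add, map_smul, flipField_apply, flip_flip]
  constructor
  · have h0 := (hasDerivAt_length_beta_move hd (ζ := 0) (f := fun _ => 0) contDiff_const
      fun _ => rfl).1 0
    have h1 := hgam 0 0
    simp only [zero_smul, add_zero] at h0 h1
    intro i
    fin_cases i
    · exact h0
    · exact h1.trans_ne h0
  · intro ξ hξ
    obtain ⟨f, hf, hξ0⟩ := hξ 0
    obtain ⟨g, hg, hξ1⟩ := hξ 1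
    have h0 := (hasDerivAt_length_beta_move hd hf hξ0).2
    have h1 := (hasDerivAt_length_beta_move hd (ζ := flipField (ξ 1))
      (flip.contDiff.comp hg) fun s => by rw [flipField_apply, hξ1]; rfl).2
    refine (h0.add h1).congr_of_eventuallyEq (Filter.Eventually.of_forall fun t => ?_)
    simp only [len, Fin.sum_univ_two, Pi.add_apply]
    congr 2
    exact hgam (ξ 1) t

/-! ### Thickness and obstacles -/

lemma gThi_fin_two (δ : Fin 2 → I → E3) :
    gThi δ = sInf (range fun k : I × I => dist (δ 0 k.1) (δ 1 k.2)) := by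
  unfold gThi
  congr 1
  ext r
  constructor
  · rintro ⟨i, j, hij, s, t, rfl⟩
    fin_cases i <;> fin_cases j
    · exact absurd rfl hij
    · exact ⟨(s, t), rfl⟩
    · exact ⟨(t, s), dist_comm _ _⟩
    · exact absurd rfl hij
  · rintro ⟨⟨s, t⟩, rfl⟩
    exact ⟨0, 1, by simp, s, t, rfl⟩

lemma obst_eq_sInf_range {ι J : Type} (g : J → E3 → ℝ) (δ : ι → I → E3) :
    obst g δ = sInf (range fun k : J × ι × I => g k.1 (δ k.2.1 k.2.2)) := by
  unfold obst
  congr 1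
  ext r
  constructor
  · rintro ⟨j, i, s, rfl⟩
    exact ⟨(j, i, s), rfl⟩
  · rintro ⟨⟨j, i, s⟩, rfl⟩
    exact ⟨j, i, s, rfl⟩

/-- The parameter on `β` of the point `u` on a clasp arc, as an element of `[0,1]`. -/
def arcPoint (k : Fin 6) (u : ℝ) : I := projIcc 0 1 zero_le_one (arcParam k u)

lemma beta_arcPoint (d : ℝ) (k : Fin 6) {u : ℝ} (hu : u ∈ Icc (0 : ℝ) 1) :
    beta d (arcPoint k u) = arcCurve k u := by
  rw [arcPoint, projIcc_of_mem _ (arcParam_mem k hu), beta_eq]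
  exact betaR_arcParam d k hu

/-- The arcs `k` of `β` and `l` of `γ` belong to the same clasp. -/
def IsOpposite (k l : Fin 6) : Prop :=
  arcDir l = arcDir k ∧ arcBase k + arcBase l = -(arcDir k * claspH)

/-- The strut from the arc `l` of `γ` to the arc `k` of `β`. -/
def strut (k l : Fin 6) (u : ℝ) : E3 :=
  !₂[arcSide k * claspX u, -(arcSide l * claspX (1 - u)), -(arcDir k * gap u)]

lemma beta_sub_gamma_eq_strut (d : ℝ) {k l : Fin 6} (h : IsOpposite k l) {u : ℝ}
    (hu : u ∈ Icc (0 : ℝ) 1) :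
    beta d (arcPoint k u) - gamma d (arcPoint l (1 - u)) = strut k l u := by
  rw [gamma_eq, beta_arcPoint d k hu, beta_arcPoint d l (one_sub_mem_Icc hu)]
  have := claspH_sub_eq_gap hu
  refine vec_ext ?_ ?_ ?_
  · simp [arcCurve, flip_apply, strut]
  · simp [arcCurve, flip_apply, strut]
  · simp only [arcCurve, flip_apply, strut, PiLp.sub_apply, Matrix.cons_val, h.1]
    linear_combination h.2 - arcDir k * this

lemma norm_strut (k l : Fin 6) {u : ℝ} (hu : u ∈ Icc (0 : ℝ) 1) : ‖strut k l u‖ = 1 := by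
  rw [← sq_eq_sq₀ (norm_nonneg _) zero_le_one, norm_vec_sq]
  have := strut_sq hu
  simp only [strut, Matrix.cons_val, neg_sq, mul_pow, arcSide_sq, arcDir_sq]
  linarith

lemma gThi_grannyClasp (d : ℝ) : gThi (grannyClasp d).arc = 1 := by
  rw [gThi_fin_two]
  refine IsLeast.csInf_eq ⟨⟨(arcPoint 1 0, arcPoint 1 (1 - 0)), ?_⟩, ?_⟩
  · have h : IsOpposite 1 1 := by
      simp only [IsOpposite, arcDir, arcBase, Matrix.cons_val]
      exact ⟨trivial, by ring⟩
    change dist (beta d _) (gamma d _) = 1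
    rw [dist_eq_norm, beta_sub_gamma_eq_strut d h (by simp), norm_strut _ _ (by simp)]
  · rintro _ ⟨k, rfl⟩
    exact one_le_dist_beta_gamma d k.1 k.2

/-- The one-sided first variation of the thickness exists, and is at most the rate of change of
length of any strut. -/
lemma exists_hasDerivWithinAt_gThi (d : ℝ) (ξ : Fin 2 → C(I, E3)) :
    ∃ a, HasDerivWithinAt (fun t : ℝ => gThi (move (grannyClasp d).arc ξ t)) a (Ici 0) 0 ∧
      ∀ k l : Fin 6, IsOpposite k l → ∀ u ∈ Icc (0 : ℝ) 1,
        a ≤ inner ℝ (strut k l u) (ξ 0 (arcPoint k u) - ξ 1 (arcPoint l (1 - u))) := by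
  set A : I × I → E3 := fun k => beta d k.1 - gamma d k.2 with hA
  set B : I × I → E3 := fun k => ξ 0 k.1 - ξ 1 k.2 with hB
  have hAc : Continuous A :=
    ((continuous_beta d).comp continuous_fst).sub ((continuous_gamma d).comp continuous_snd)
  have hBc : Continuous B := by fun_prop
  have hA1 : ∀ k, 1 ≤ ‖A k‖ := fun k => by
    rw [hA, ← dist_eq_norm]
    exact one_le_dist_beta_gamma d k.1 k.2
  obtain ⟨M, hM⟩ := isCompact_univ.exists_bound_of_continuousOn (hBc.continuousOn (s := univ))
  have hM0 : 0 ≤ M := (norm_nonneg _).trans (hM (0, 0) (mem_univ _))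
  -- The choice of `δ` keeps `t * ‖B k‖ ≤ 1/2`, as the second-order estimate for the norm requires.
  have h := hasDerivWithinAt_sInf_range (φ := fun t k => ‖A k + t • B k‖)
    (D := fun k => inner ℝ (A k) (B k) / ‖A k‖) (C := M ^ 2) (δ := 1 / (2 * (M + 1)))
    (by simpa using hAc.norm)
    ((hAc.inner hBc).div hAc.norm fun k => (one_pos.trans_le (hA1 k)).ne') (by positivity) ?_
  · obtain ⟨a, ha, -, hmin⟩ := h
    refine ⟨a, ?_, fun k l hkl u hu => ?_⟩
    · have hmove : ∀ t : ℝ, gThi (move (grannyClasp d).arc ξ t) =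
          sInf (range fun k => ‖A k + t • B k‖) := by
        intro t
        rw [gThi_fin_two]
        congr 2
        funext k
        rw [dist_eq_norm]
        congr 1
        change beta d k.1 + t • ξ 0 k.1 - (gamma d k.2 + t • ξ 1 k.2) = _
        simp only [hA, hB, smul_sub]
        abel
      exact ha.congr (fun t _ => hmove t) (hmove 0)
    · have e : A (arcPoint k u, arcPoint l (1 - u)) = strut k l u :=
        beta_sub_gamma_eq_strut d hkl hu
      -- Every strut has length 1, the minimum, so it is among the minimizers in Danskin's theorem.
      have hle := hmin (arcPoint k u, arcPoint l (1 - u)) fun k' => by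
        simp only [zero_smul, add_zero, e, norm_strut k l hu]
        exact hA1 k'
      simpa only [e, norm_strut k l hu, div_one] using hle
  · intro t ht0 ht k
    have hk := hM k (mem_univ k)
    simp only [zero_smul, add_zero]
    refine (abs_norm_add_smul_sub_le (hA1 k) ?_).trans ?_
    · rw [abs_of_nonneg ht0]
      rw [le_div_iff₀ (by positivity)] at ht
      nlinarith
    · gcongr

/-- Each obstacle function is affine along the motion, so Danskin's theorem applies with zero error
constant. -/
lemma exists_hasDerivWithinAt_obst (d : ℝ) (ξ : Fin 2 → C(I, E3)) :
    ∃ b, HasDerivWithinAt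
      (fun t : ℝ => obst (grannyClasp d).g (move (grannyClasp d).arc ξ t)) b (Ici 0) 0 := by
  have hc : ∀ i, Continuous ((grannyClasp d).arc i) := by
    intro i
    fin_cases i
    · exact continuous_beta d
    · exact continuous_gamma d
  have hg : ∀ j, Continuous ((grannyClasp d).g j) := by
    intro j
    fin_cases j
    · change Continuous fun q : E3 => q 2 + ceil d
      fun_prop
    · change Continuous fun q : E3 => ceil d - q 2
      fun_prop
  have hD : Continuous fun k : Fin 2 × Fin 2 × I => (![1, -1] : Fin 2 → ℝ) k.1 *
      ξ k.2.1 k.2.2 2 := by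
    rw [continuous_prod_of_discrete_left]
    intro j
    rw [continuous_prod_of_discrete_left]
    intro i
    fun_prop
  have h0 : Continuous fun k : Fin 2 × Fin 2 × I =>
      (grannyClasp d).g k.1 (move (grannyClasp d).arc ξ 0 k.2.1 k.2.2) := by
    rw [continuous_prod_of_discrete_left]
    intro j
    rw [continuous_prod_of_discrete_left]
    intro i
    exact (hg j).comp ((hc i).add ((ξ i).continuous.const_smul (0 : ℝ)))
  have hlin : ∀ (t : ℝ) (k : Fin 2 × Fin 2 × I),
      (grannyClasp d).g k.1 (move (grannyClasp d).arc ξ t k.2.1 k.2.2)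
        - (grannyClasp d).g k.1 (move (grannyClasp d).arc ξ 0 k.2.1 k.2.2)
        - t * ((![1, -1] : Fin 2 → ℝ) k.1 * ξ k.2.1 k.2.2 2) = 0 := by
    rintro t ⟨j, i, s⟩
    fin_cases j
    · simp [grannyClasp, move]
    · simp [grannyClasp, move]
  obtain ⟨b, hb, -⟩ := hasDerivWithinAt_sInf_range
    (φ := fun t (k : Fin 2 × Fin 2 × I) =>
      (grannyClasp d).g k.1 (move (grannyClasp d).arc ξ t k.2.1 k.2.2))
    (C := 0) h0 hD one_pos fun t _ _ k => by rw [hlin t k, abs_zero, zero_mul]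
  exact ⟨b, hb.congr (fun t _ => obst_eq_sInf_range _ _) (obst_eq_sInf_range _ _)⟩

/-! ### Balance -/

/-- The two arcs of `γ` opposite to each arc of `β`. -/
def opposite : Fin 2 → Fin 6 → Fin 6 := ![![2, 1, 0, 0, 1, 2], ![3, 4, 5, 5, 4, 3]]

lemma opposite_spec (m : Fin 2) (k : Fin 6) : IsOpposite k (opposite m k) := by
  fin_cases m <;> fin_cases k <;>
    simp only [IsOpposite, opposite, arcDir, arcBase] <;>
    simp <;> ring

/-- The rate of change of the total length of the struts at parameter `u`. -/
def strutRate (ξ : Fin 2 → C(I, E3)) (u : ℝ) : ℝ :=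
  ∑ k, ∑ m, inner ℝ (strut k (opposite m k) u)
    (ξ 0 (arcPoint k u) - ξ 1 (arcPoint (opposite m k) (1 - u)))

/-- The curvature forces are balanced by the struts. -/
lemma strutRate_eq (ξ : Fin 2 → C(I, E3)) {u : ℝ} (hu : u ∈ Ioo (0 : ℝ) 1) :
    strutRate ξ u = 2 * gap u * (∑ k, inner ℝ (arcForce k u) (ξ 0 (arcPoint k u))
      + ∑ l, inner ℝ (arcForce l (1 - u)) (flip (ξ 1 (arcPoint l (1 - u))))) := by
  -- The two arcs opposite to an arc lie on opposite sides of the axis, so the transverse parts of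
  -- their struts cancel. Orthogonality at both ends turns the rest into `2 * gap u` times the force
  -- densities; each arc of `γ` also occurs exactly twice in `opposite`.
  have e1 := claspX_eq_gap_mul_slope hu
  have e2 := claspX_eq_gap_mul_slope (one_sub_mem_Ioo hu)
  rw [gap_one_sub] at e2
  unfold strutRate
  generalize hx : (fun k => ξ 0 (arcPoint k u)) = x
  generalize hy : (fun l => ξ 1 (arcPoint l (1 - u))) = y
  have hx' : ∀ k, ξ 0 (arcPoint k u) = x k := congrFun hx
  have hy' : ∀ l, ξ 1 (arcPoint l (1 - u)) = y l := congrFun hy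
  simp only [hx', hy', Fin.sum_univ_six, Fin.sum_univ_two, inner_vec, strut, arcForce, flip_apply,
    arcSide, arcDir, opposite, e1, e2, PiLp.sub_apply, Matrix.cons_val]
  ring

lemma grannyVariation_eq_integral {d : ℝ} {ξ : Fin 2 → C(I, E3)}
    (hξ : (grannyClasp d).Compatible ξ) :
    IntervalIntegrable (fun u => strutRate ξ u / (2 * gap u)) volume 0 1 ∧
    grannyVariation ξ = ∫ u in (0 : ℝ)..1, strutRate ξ u / (2 * gap u) := by
  have h0 := hξ 0
  have h1 := hξ 1
  simp only [grannyClasp, Matrix.cons_val_zero, Matrix.cons_val_one,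
    mem_horizontalPlane_direction] at h0 h1
  have i0 := intervalIntegrable_arcForce_inner (ξ 0)
  have i1 : ∀ k, IntervalIntegrable (fun u => inner ℝ (arcForce k (1 - u))
      (fieldAt (flipField (ξ 1)) (arcParam k (1 - u)))) volume 0 1 := fun k => by
    simpa using ((intervalIntegrable_arcForce_inner (flipField (ξ 1)) k).comp_sub_left 1).symm
  have hsum : IntervalIntegrable (fun u =>
      ∑ k, inner ℝ (arcForce k u) (fieldAt (ξ 0) (arcParam k u))
      + ∑ k, inner ℝ (arcForce k (1 - u)) (fieldAt (flipField (ξ 1)) (arcParam k (1 - u))))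
      volume 0 1 := by
    refine IntervalIntegrable.add ?_ ?_
    · simpa only [Finset.sum_fn] using IntervalIntegrable.sum Finset.univ fun k _ => i0 k
    · simpa only [Finset.sum_fn] using IntervalIntegrable.sum Finset.univ fun k _ => i1 k
  have heq : EqOn (fun u => ∑ k, inner ℝ (arcForce k u) (fieldAt (ξ 0) (arcParam k u))
      + ∑ k, inner ℝ (arcForce k (1 - u)) (fieldAt (flipField (ξ 1)) (arcParam k (1 - u))))
      (fun u => strutRate ξ u / (2 * gap u)) (Ioo 0 1) := by
    intro u hu
    have hg := gap_pos hu
    simp only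
    rw [eq_div_iff (by positivity), strutRate_eq ξ hu, mul_comm]
    rfl
  refine ⟨hsum.congr_uIoo (by rwa [uIoo_of_le zero_le_one]), ?_⟩
  have hint : ∫ u in (0 : ℝ)..1, strutRate ξ u / (2 * gap u) =
      ∫ u in (0 : ℝ)..1, (∑ k, inner ℝ (arcForce k u) (fieldAt (ξ 0) (arcParam k u))
        + ∑ k, inner ℝ (arcForce k (1 - u)) (fieldAt (flipField (ξ 1)) (arcParam k (1 - u)))) := by
    exact intervalIntegral.integral_congr_Ioo_of_le zero_le_one heq.symm
  rw [hint, intervalIntegral.integral_add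
    (by simpa only [Finset.sum_fn] using IntervalIntegrable.sum Finset.univ fun k _ => i0 k)
    (by simpa only [Finset.sum_fn] using IntervalIntegrable.sum Finset.univ fun k _ => i1 k),
    intervalIntegral.integral_finsetSum fun k _ => i0 k,
    intervalIntegral.integral_finsetSum fun k _ => i1 k, grannyVariation_apply,
    betaVariation_apply, betaVariation_apply]
  -- Compatibility makes the field horizontal at the endpoints, which removes the boundary terms of
  -- the first variation.
  have hz : ∀ s, flipField (ξ 1) s 2 = -(ξ 1 s 2) := fun s => rfl
  rw [hz, hz, h0.1, h0.2, h1.1, h1.2]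
  simp only [neg_zero, sub_zero, zero_add, arcWork_apply]
  congr 1
  refine Finset.sum_congr rfl fun k _ => ?_
  simpa using (intervalIntegral.integral_comp_sub_left (a := 0) (b := 1)
    (fun u => inner ℝ (arcForce k u) (fieldAt (flipField (ξ 1)) (arcParam k u))) 1).symm

lemma stronglyCritical_grannyClasp {d : ℝ} (hd : 0 < d) : (grannyClasp d).StronglyCritical := by
  -- In `ε = 1 / (6 * ∫ 1 / gap)`, the factor `6` is twelve struts per parameter times the weight `1
  -- / (2 * gap u)`.
  have hJ : 0 < ∫ u in (0 : ℝ)..1, 1 / gap u :=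
    intervalIntegral.intervalIntegral_pos_of_pos_on intervalIntegrable_inv_gap
      (fun u hu => one_div_pos.2 (gap_pos hu)) zero_lt_one
  refine ⟨grannyVariation, isFirstVariationOfLen_grannyVariation hd,
    1 / (6 * ∫ u in (0 : ℝ)..1, 1 / gap u), by positivity, fun ξ hξ hF => ?_⟩
  obtain ⟨a, ha, hstrut⟩ := exists_hasDerivWithinAt_gThi d ξ
  obtain ⟨b, hb⟩ := exists_hasDerivWithinAt_obst d ξ
  refine ⟨a, b, ha, hb, (min_le_left a b).trans ?_⟩
  obtain ⟨hi, hG⟩ := grannyVariation_eq_integral hξ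
  -- All twelve strut rates are at least `a`, and the strut weights are positive; the right-hand
  -- side is the variation of length, namely `-1`.
  have hle : ∫ u in (0 : ℝ)..1, 6 * a * (1 / gap u) ≤
      ∫ u in (0 : ℝ)..1, strutRate ξ u / (2 * gap u) := by
    refine intervalIntegral.integral_mono_on_of_le_Ioo zero_le_one
      (intervalIntegrable_inv_gap.const_mul _) hi fun u hu => ?_
    have hg := gap_pos hu
    have h12 : 12 * a ≤ strutRate ξ u := by
      have : ∑ _k : Fin 6, ∑ _m : Fin 2, a ≤ strutRate ξ u :=
        Finset.sum_le_sum fun k _ => Finset.sum_le_sum fun m _ =>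
          hstrut k _ (opposite_spec m k) u (Ioo_subset_Icc_self hu)
      simp only [Finset.sum_const, Finset.card_univ, Fintype.card_fin, smul_smul] at this
      norm_num at this
      linarith
    rw [mul_one_div, div_le_div_iff₀ hg (by positivity)]
    nlinarith
  rw [intervalIntegral.integral_const_mul, ← hG, hF] at hle
  rw [← neg_div, le_div_iff₀ (by positivity)]
  linarith

end Gehring

end

theorem theorem7p1 (d : ℝ) (hd : 0 < d) :
    -- the configuration is a generalized link, of Gehring thickness `1`
    (Gehring.grannyClasp d).IsGenLink ∧
    Gehring.gThi (Gehring.grannyClasp d).arc = 1 ∧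
    -- it is in the link-homotopy class of the granny clasp
    (Gehring.grannyClasp d).LinkHomotopicTo (Gehring.grannyPicture (Gehring.ceil d)) ∧
    -- it is not embedded: each component has exactly one self-intersection
    (∀ i : Fin 2, ∃! q : Gehring.E3, ∃ s t : unitInterval, s ≠ t ∧
      (Gehring.grannyClasp d).arc i s = q ∧ (Gehring.grannyClasp d).arc i t = q) ∧
    -- it is strongly critical for Gehring ropelength
    (Gehring.grannyClasp d).StronglyCritical :=
  ⟨Gehring.grannyClasp_isGenLink hd, Gehring.gThi_grannyClasp d,
    Gehring.grannyClasp_linkHomotopicTo hd, Gehring.existsUnique_self_intersection hd,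
    Gehring.stronglyCritical_grannyClasp hd⟩
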